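/- Let $\Bbbk$ be a field of characteristic $0$ and let $n\ge 0$. For a polynomial $p\in\Bbbk[x]$ with $p(0)=0$ let $\circ_p$ denote the substitution map $f(x_1,\ldots,x_n)\mapsto f(p(x_1),\ldots,p(x_n))$ on $\Bbbk[x_1,\ldots,x_n]$. Let $S\subset\Bbbk[x_1,\ldots,x_n]$ be a $\Bbbk$-linear subspace that is closed under $\circ_p$ for all $p\in\Bbbk[x]$ with $p(0)=0$. For $d\ge 0$ let $S_d$ be the (finite-dimensional) subspace of all elements of $S$ that are homogeneous of degree $d$ (including $0$). Then: (1) $S$ is graded by the degree of polynomials: $S=\bigoplus_{d=0}^{\infty}S_d$. (2) $S$ is generated by a finite set under substitutions and linear combinations: there is a finite set $T$ such that $S$ is the smallest linear subspace of $\Bbbk[x_1,\ldots,x_n]$ that contains $T$ and is closed under $\circ_p$ for all $p\in\Bbbk[x]$ with $p(0)=0$. (3) The generating series $F_S(t):=\sum_{d=0}^{\infty}(\dim_{\Bbbk} S_d)\,t^d$ is a rational function: there are polynomials $P,Q\in\mathbb{Q}[t]$ with $Q(0)\neq 0$ and $Q(t)F_S(t)=P(t)$. -/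

import Mathlib

noncomputable section

namespace SubstSpace

/-- The substitution map `f(x₁, …, xₙ) ↦ f(p(x₁), …, p(xₙ))` on `k[x₁, …, xₙ]`. -/
def subst {k : Type*} [Field k] {n : ℕ} (p : Polynomial k) :
    MvPolynomial (Fin n) k →ₐ[k] MvPolynomial (Fin n) k :=
  MvPolynomial.aeval fun i => Polynomial.aeval (MvPolynomial.X i : MvPolynomial (Fin n) k) p

/-- A subspace is closed under the substitutions `x_i ↦ p(x_i)` for all `p` with `p(0) = 0`. -/
def IsSubstClosed {k : Type*} [Field k] {n : ℕ}
    (S : Submodule k (MvPolynomial (Fin n) k)) : Prop :=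
  ∀ p : Polynomial k, p.eval 0 = 0 → ∀ f ∈ S, subst p f ∈ S

/-- The subspace generated by a set `T` under substitutions and linear combinations: the smallest
substitution-closed subspace that contains `T`. -/
def substSpan {k : Type*} [Field k] {n : ℕ} (T : Set (MvPolynomial (Fin n) k)) :
    Submodule k (MvPolynomial (Fin n) k) :=
  sInf {W | T ⊆ W ∧ IsSubstClosed W}

/-- The subspace `S_d` of `S` of all elements that are homogeneous of degree `d` (zero included). -/
def gradedPiece {k : Type*} [Field k] {n : ℕ}
    (S : Submodule k (MvPolynomial (Fin n) k)) (d : ℕ) : Submodule k S :=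
  (MvPolynomial.homogeneousSubmodule (Fin n) k d).comap S.subtype

/-- The generating series `∑_d (dim S_d) t^d`. -/
def generatingSeries {k : Type*} [Field k] {n : ℕ}
    (S : Submodule k (MvPolynomial (Fin n) k)) : PowerSeries ℚ :=
  PowerSeries.mk fun d => (Module.finrank k (gradedPiece S d) : ℚ)

end SubstSpace

end

/-! Write `f(x + t x^(m+1))` as a polynomial in `t`. Its values lie in `S`, so its coefficients do
too, and the linear one is `L_m f` with `L_m = ∑ xᵢ^(m+1) ∂ᵢ`. Thus `S` is closed under all `L_m`,
`m ≥ 0`. The Euler operator `L_0` gives the grading; the rest uses only closure under the `L_m`.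

The statement is generalized to tensor densities, where `L_m` gains the term `∑ (m+1) wᵢ xᵢ^m` and
`L_0` also a constant `v`. `good_bot_top` shows, by induction on the number of variables, that every
closed subspace is finitely generated and has a rational Hilbert series. Both properties pass
through extensions, so they are studied on intervals `A ≤ S ≤ C` (`GoodInt`).

Let `l` be `xᵢ` or `xᵢ - xⱼ`. The quotient of the multiples of `l^j` by those of `l^(j+1)` is a
density module in one variable fewer (`goodForm_of_restrict`). Hence the quotient by any power of
the product of these forms is good. A weight `1` is reduced to weight `0` by differentiation
(`good_of_weight_one`). It remains to treat `S` inside the multiples of `x₁⋯xₙ` with no weight equal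
to `1`.

There, combining products of `n` operators with the coefficients of a symmetric polynomial that
vanishes to high order on the diagonals leaves only the terms in which each operator acts on its own
variable (`transvect_mem`). Composing two such operations and taking the top coefficient in an
auxiliary integer `t` yields multiplication by symmetric polynomials, up to Euler operators in the
variables of weight `0` (`transvect_transvect_eq`). These are removed in
`exists_conductor_pow_mul_mem`. So if `K` is the module over symmetric polynomials spanned by `S`,
then `bK ≤ S ≤ K` for a power `b` of one symmetric polynomial. As `K` is Noetherian, Artin–Rees
places `K/bK` under the induction hypothesis, and `H_K - t^e H_K` being rational makes `H_K` and
then `H_S` rational. -/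

namespace SubstSpace

/-! ### Graded operator modules and intervals of closed subspaces -/

section Interval

variable {k X Y : Type*} [Field k] [AddCommGroup X] [Module k X] [AddCommGroup Y] [Module k Y]

/-- A subspace is closed under a family of operators. -/
def OpClosed (L : ℕ → Module.End k X) (S : Submodule k X) : Prop :=
  ∀ m, ∀ x ∈ S, L m x ∈ S

/-- The operator `D` has natural number eigenvalues and finite-dimensional eigenspaces that
span the whole space. -/
structure IsGrading (D : Module.End k X) : Prop where
  iSup_eq_top : ⨆ d : ℕ, D.eigenspace (d : k) = ⊤
  finite : ∀ d : ℕ, FiniteDimensional k (D.eigenspace (d : k))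

/-- The generating series of the dimensions of the eigenspaces of `D` in `S`. -/
noncomputable def hilb (D : Module.End k X) (S : Submodule k X) : PowerSeries ℚ :=
  PowerSeries.mk fun d => (Module.finrank k ↥(S ⊓ D.eigenspace (d : k)) : ℚ)

/-- A power series that is a quotient of polynomials. -/
def IsRationalSeries (F : PowerSeries ℚ) : Prop :=
  ∃ P Q : Polynomial ℚ, Q.coeff 0 ≠ 0 ∧ (Q : PowerSeries ℚ) * F = (P : PowerSeries ℚ)

theorem IsRationalSeries.zero : IsRationalSeries 0 :=
  ⟨0, 1, by simp, by simp⟩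

theorem IsRationalSeries.add {F G : PowerSeries ℚ} (hF : IsRationalSeries F)
    (hG : IsRationalSeries G) : IsRationalSeries (F + G) := by
  obtain ⟨P, Q, hQ, h⟩ := hF
  obtain ⟨P', Q', hQ', h'⟩ := hG
  refine ⟨P * Q' + P' * Q, Q * Q', ?_, ?_⟩
  · rw [Polynomial.mul_coeff_zero]; exact mul_ne_zero hQ hQ'
  · push_cast
    rw [← h, ← h']; ring

theorem IsRationalSeries.neg {F : PowerSeries ℚ} (hF : IsRationalSeries F) :
    IsRationalSeries (-F) := by
  obtain ⟨P, Q, hQ, h⟩ := hF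
  refine ⟨-P, Q, hQ, ?_⟩
  rw [mul_neg, h]; push_cast; rfl

theorem IsRationalSeries.sub {F G : PowerSeries ℚ} (hF : IsRationalSeries F)
    (hG : IsRationalSeries G) : IsRationalSeries (F - G) := by
  rw [sub_eq_add_neg]; exact hF.add hG.neg

theorem IsRationalSeries.of_mul {F : PowerSeries ℚ} {R : Polynomial ℚ} (hR : R.coeff 0 ≠ 0)
    (h : IsRationalSeries ((R : PowerSeries ℚ) * F)) : IsRationalSeries F := by
  obtain ⟨P, Q, hQ, h⟩ := h
  refine ⟨P, Q * R, ?_, ?_⟩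
  · rw [Polynomial.mul_coeff_zero]; exact mul_ne_zero hQ hR
  · push_cast; rw [mul_assoc, h]

/-- `S` is generated, modulo `A`, by finitely many of its elements. -/
def FGMod (L : ℕ → Module.End k X) (A S : Submodule k X) : Prop :=
  ∃ T : Finset X, (T : Set X) ⊆ S ∧
    ∀ W : Submodule k X, OpClosed L W → A ≤ W → (T : Set X) ⊆ W → S ≤ W

/-- All closed subspaces between `A` and `C` are finitely generated modulo `A` and have a rational
Hilbert series relative to `A`. -/
def GoodInt (L : ℕ → Module.End k X) (A C : Submodule k X) : Prop :=
  ∀ S : Submodule k X, OpClosed L S → A ≤ S → S ≤ C →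
    FGMod L A S ∧ IsRationalSeries (hilb (L 0) S - hilb (L 0) A)

variable {L : ℕ → Module.End k X} {A B C S : Submodule k X}

theorem OpClosed.bot : OpClosed L ⊥ := by
  intro m x hx
  rw [Submodule.mem_bot] at hx
  simp [hx]

theorem OpClosed.inf (hA : OpClosed L A) (hB : OpClosed L B) : OpClosed L (A ⊓ B) :=
  fun m x hx => ⟨hA m x hx.1, hB m x hx.2⟩

theorem OpClosed.sup (hA : OpClosed L A) (hB : OpClosed L B) : OpClosed L (A ⊔ B) := by
  intro m x hx
  obtain ⟨a, ha, b, hb, rfl⟩ := Submodule.mem_sup.1 hx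
  rw [map_add]
  exact Submodule.add_mem_sup (hA m a ha) (hB m b hb)

theorem OpClosed.map {L' : ℕ → Module.End k Y} (π : X →ₗ[k] Y)
    (hπ : ∀ m x, π (L m x) = L' m (π x)) (hA : OpClosed L A) : OpClosed L' (A.map π) := by
  rintro m _ ⟨x, hx, rfl⟩
  exact ⟨L m x, hA m x hx, hπ m x⟩

theorem OpClosed.comap {L' : ℕ → Module.End k Y} (π : X →ₗ[k] Y)
    (hπ : ∀ m x, π (L m x) = L' m (π x)) {A : Submodule k Y} (hA : OpClosed L' A) :
    OpClosed L (A.comap π) := by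
  intro m x hx
  rw [Submodule.mem_comap, hπ]
  exact hA m _ hx

/-- Applying `D - d₀` kills one component and rescales the others by factors that are nonzero in
characteristic zero. -/
theorem mem_of_sum_eigenvectors_mem [CharZero k] {D : Module.End k X} {S : Submodule k X}
    (hS : ∀ x ∈ S, D x ∈ S) (F : Finset ℕ) (x : ℕ → X)
    (hx : ∀ d ∈ F, x d ∈ D.eigenspace (d : k)) (hsum : ∑ d ∈ F, x d ∈ S) :
    ∀ d ∈ F, x d ∈ S := by
  induction F using Finset.induction_on generalizing x with
  | empty => simp
  | insert d₀ F hd₀ ih =>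
    have h1 : ∀ d ∈ F, ((d : k) - d₀) • x d ∈ S := by
      apply ih
      · intro d hd
        exact Submodule.smul_mem _ _ (hx d (Finset.mem_insert_of_mem hd))
      · have h2 := S.sub_mem (hS _ hsum) (S.smul_mem (d₀ : k) hsum)
        convert h2 using 1
        rw [map_sum, Finset.smul_sum, ← Finset.sum_sub_distrib, Finset.sum_insert hd₀]
        rw [Module.End.mem_eigenspace_iff.1 (hx d₀ (Finset.mem_insert_self _ _)), sub_self,
          zero_add]
        refine Finset.sum_congr rfl fun d hd => ?_
        rw [Module.End.mem_eigenspace_iff.1 (hx d (Finset.mem_insert_of_mem hd)), sub_smul]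
    have h3 : ∀ d ∈ F, x d ∈ S := by
      intro d hd
      have hne : (d : k) - d₀ ≠ 0 := by
        rw [sub_ne_zero]
        rintro h
        exact hd₀ (Nat.cast_injective h ▸ hd)
      exact (Submodule.smul_mem_iff _ hne).1 (h1 d hd)
    rw [Finset.sum_insert hd₀] at hsum
    intro d hd
    rcases Finset.mem_insert.1 hd with rfl | hd
    · exact (Submodule.add_mem_iff_left _ (S.sum_mem h3)).1 hsum
    · exact h3 d hd

theorem IsGrading.eq_iSup_inf [CharZero k] {D : Module.End k X} (hD : IsGrading D)
    (hS : ∀ x ∈ S, D x ∈ S) : S = ⨆ d : ℕ, S ⊓ D.eigenspace (d : k) := by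
  refine le_antisymm (fun x hx => ?_) (iSup_le fun d => inf_le_left)
  have h : x ∈ ⨆ d : ℕ, D.eigenspace (d : k) := by rw [hD.iSup_eq_top]; trivial
  obtain ⟨f, hf, rfl⟩ := (Submodule.mem_iSup_iff_exists_finsupp _ _).1 h
  rw [Finsupp.sum]
  refine Submodule.sum_mem _ fun d hd => ?_
  refine Submodule.mem_iSup_of_mem d ⟨?_, hf d⟩
  exact mem_of_sum_eigenvectors_mem hS f.support f (fun d _ => hf d) hx d hd

theorem IsGrading.exists_component [CharZero k] {D : Module.End k X} (hD : IsGrading D)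
    (hS : ∀ x ∈ S, D x ∈ S) (d : ℕ) {x : X} (hx : x ∈ S) :
    ∃ y ∈ S ⊓ D.eigenspace (d : k), x - y ∈ ⨆ (e : ℕ) (_ : e ≠ d), D.eigenspace (e : k) := by
  rw [hD.eq_iSup_inf hS, iSup_split_single _ d] at hx
  obtain ⟨y, hy, z, hz, rfl⟩ := Submodule.mem_sup.1 hx
  refine ⟨y, hy, ?_⟩
  rw [add_sub_cancel_left]
  exact (iSup₂_mono fun e _ => inf_le_right :
    (⨆ (e : ℕ) (_ : e ≠ d), S ⊓ D.eigenspace (e : k)) ≤ _) hz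

theorem eigenspace_disjoint [CharZero k] (D : Module.End k X) (d : ℕ) {x : X}
    (hx : x ∈ D.eigenspace (d : k))
    (hx' : x ∈ ⨆ (e : ℕ) (_ : e ≠ d), D.eigenspace (e : k)) : x = 0 := by
  have h := D.eigenspaces_iSupIndep.comp (f := fun d : ℕ => (d : k)) Nat.cast_injective
  exact (Submodule.disjoint_def.1 (h d)) x hx hx'

/-- The degree `d` component of a preimage is again a preimage: the other components land in
eigenspaces that are independent of the `d`-th one. -/
theorem IsGrading.map_inf_eigenspace [CharZero k] {D : Module.End k X} {D' : Module.End k Y}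
    (hD : IsGrading D) (π : X →ₗ[k] Y) (hπ : ∀ x, π (D x) = D' (π x))
    (hS : ∀ x ∈ S, D x ∈ S) (d : ℕ) :
    (S ⊓ D.eigenspace (d : k)).map π = S.map π ⊓ D'.eigenspace (d : k) := by
  have hmap : ∀ e : ℕ, (D.eigenspace (e : k)).map π ≤ D'.eigenspace (e : k) := by
    rintro e _ ⟨x, hx, rfl⟩
    have hx := Module.End.mem_eigenspace_iff.1 hx
    rw [Module.End.mem_eigenspace_iff, ← hπ, hx, map_smul]
  apply le_antisymm
  · exact le_inf (Submodule.map_mono inf_le_left)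
      ((Submodule.map_mono inf_le_right).trans (hmap d))
  · rintro _ ⟨⟨x, hx, rfl⟩, hy⟩
    obtain ⟨y, hy', hxy⟩ := hD.exists_component hS d hx
    refine ⟨y, hy', ?_⟩
    have h0 : π (x - y) = 0 := by
      apply eigenspace_disjoint D' d
      · rw [map_sub]
        exact Submodule.sub_mem _ hy (hmap d ⟨y, hy'.2, rfl⟩)
      · have := Submodule.mem_map_of_mem (f := π) hxy
        simp only [Submodule.map_iSup] at this
        exact (iSup₂_mono fun e _ => hmap e) this
    rw [map_sub, sub_eq_zero] at h0
    exact h0.symm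

theorem IsGrading.sup_inf_eigenspace [CharZero k] {D : Module.End k X} (hD : IsGrading D)
    (hA : ∀ x ∈ A, D x ∈ A) (hB : ∀ x ∈ B, D x ∈ B) (d : ℕ) :
    (A ⊔ B) ⊓ D.eigenspace (d : k) = (A ⊓ D.eigenspace (d : k)) ⊔ (B ⊓ D.eigenspace (d : k)) := by
  apply le_antisymm
  · rintro x ⟨hx, hxd⟩
    obtain ⟨a, ha, b, hb, rfl⟩ := Submodule.mem_sup.1 hx
    obtain ⟨a', ha', haa⟩ := hD.exists_component hA d ha
    obtain ⟨b', hb', hbb⟩ := hD.exists_component hB d hb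
    have : a + b - (a' + b') = 0 := by
      apply eigenspace_disjoint D d
      · exact Submodule.sub_mem _ hxd (Submodule.add_mem _ ha'.2 hb'.2)
      · rw [add_sub_add_comm]
        exact Submodule.add_mem _ haa hbb
    rw [sub_eq_zero] at this
    rw [this]
    exact Submodule.add_mem_sup ha' hb'
  · exact sup_le (inf_le_inf_right _ le_sup_left) (inf_le_inf_right _ le_sup_right)

theorem IsGrading.finite_inf {D : Module.End k X} (hD : IsGrading D) (S : Submodule k X) (d : ℕ) :
    FiniteDimensional k ↥(S ⊓ D.eigenspace (d : k)) :=
  have := hD.finite d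
  Submodule.finiteDimensional_of_le (inf_le_right : S ⊓ D.eigenspace (d : k) ≤ _)

theorem IsGrading.hilb_sup_add_hilb_inf [CharZero k] {D : Module.End k X} (hD : IsGrading D)
    (hA : ∀ x ∈ A, D x ∈ A) (hB : ∀ x ∈ B, D x ∈ B) :
    hilb D (A ⊔ B) + hilb D (A ⊓ B) = hilb D A + hilb D B := by
  ext d
  simp only [hilb, map_add, PowerSeries.coeff_mk]
  have := hD.finite_inf A d
  have := hD.finite_inf B d
  rw [hD.sup_inf_eigenspace hA hB, inf_inf_distrib_right]
  exact_mod_cast Submodule.finrank_sup_add_finrank_inf_eq _ _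

theorem IsGrading.hilb_map [CharZero k] {D : Module.End k X} {D' : Module.End k Y}
    (hD : IsGrading D) (π : X →ₗ[k] Y) (hπ : ∀ x, π (D x) = D' (π x))
    (hS : ∀ x ∈ S, D x ∈ S) :
    hilb D' (S.map π) + hilb D (S ⊓ LinearMap.ker π) = hilb D S := by
  ext d
  simp only [hilb, map_add, PowerSeries.coeff_mk]
  have := hD.finite_inf S d
  rw [← hD.map_inf_eigenspace π hπ hS]
  have h := LinearMap.finrank_range_add_finrank_ker (π.domRestrict (S ⊓ D.eigenspace (d : k)))
  rw [LinearMap.range_domRestrict] at h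
  rw [← h]
  push_cast
  congr 2
  rw [LinearMap.ker_domRestrict, ← Submodule.finrank_map_subtype_eq, Submodule.map_comap_subtype,
    inf_right_comm]

theorem GoodInt.mono [CharZero k] {A' B' : Submodule k X} (h : GoodInt L A B) (hA' : OpClosed L A')
    (hA : A ≤ A') (hAB : A' ≤ B) (hB : B' ≤ B) : GoodInt L A' B' := by
  intro S hS hAS hSB
  obtain ⟨⟨T, hT, hgen⟩, hr⟩ := h S hS (hA.trans hAS) (hSB.trans hB)
  refine ⟨⟨T, hT, fun W hW hAW hTW => hgen W hW (hA.trans hAW) hTW⟩, ?_⟩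
  have hr' := (h A' hA' hA hAB).2
  convert hr.sub hr' using 1
  ring

/-- `S` is an extension of `(S ⊔ B)/B` by `(S ⊓ B)/A`; generators of the former are lifted to `S`
modulo `B`. -/
theorem GoodInt.trans [CharZero k] (hL : IsGrading (L 0)) (hB : OpClosed L B) (hAB : A ≤ B)
    (hBC : B ≤ C) (h₁ : GoodInt L A B) (h₂ : GoodInt L B C) : GoodInt L A C := by
  intro S hS hAS hSC
  obtain ⟨⟨T₁, hT₁, hgen₁⟩, hr₁⟩ := h₁ (S ⊓ B) (hS.inf hB) (le_inf hAS hAB) inf_le_right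
  obtain ⟨⟨T₂, hT₂, hgen₂⟩, hr₂⟩ := h₂ (S ⊔ B) (hS.sup hB) le_sup_right (sup_le hSC hBC)
  have hdec : ∀ t ∈ T₂, ∃ s ∈ S, ∃ b ∈ B, s + b = t := fun t ht => Submodule.mem_sup.1 (hT₂ ht)
  classical
  choose! s hs b hb hsb using hdec
  refine ⟨⟨T₁ ∪ T₂.image s, ?_, ?_⟩, ?_⟩
  · rw [Finset.coe_union, Set.union_subset_iff]
    refine ⟨fun x hx => (hT₁ hx).1, ?_⟩
    intro x hx
    obtain ⟨t, ht, rfl⟩ := Finset.mem_image.1 hx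
    exact hs t ht
  · intro W hW hAW hTW
    rw [Finset.coe_union, Set.union_subset_iff] at hTW
    have h1 : S ⊓ B ≤ W := hgen₁ W hW hAW hTW.1
    -- Intersecting `W` with `S` forces the error term in `B` to lie in `S ⊓ B`, which is already
    -- covered.
    have h2 : S ⊔ B ≤ (W ⊓ S) ⊔ B := by
      apply hgen₂ _ ((hW.inf hS).sup hB) le_sup_right
      intro t ht
      rw [← hsb t ht]
      exact Submodule.add_mem_sup
        ⟨hTW.2 (Finset.mem_image_of_mem s ht), hs t ht⟩ (hb t ht)
    intro x hx
    obtain ⟨w, hw, b', hb', rfl⟩ := Submodule.mem_sup.1 (h2 (Submodule.mem_sup_left hx))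
    refine W.add_mem hw.1 (h1 ⟨?_, hb'⟩)
    exact (Submodule.add_mem_iff_right _ hw.2).1 hx
  · have := hL.hilb_sup_add_hilb_inf (hS 0) (hB 0)
    convert hr₁.add hr₂ using 1
    rw [eq_sub_iff_add_eq.2 this]
    ring

/-- The second isomorphism theorem, `(A ⊔ C)/A ≅ C/(A ⊓ C)`. -/
theorem GoodInt.inf_of_sup [CharZero k] (hL : IsGrading (L 0)) (hA : OpClosed L A)
    (h : GoodInt L A (A ⊔ C)) : GoodInt L (A ⊓ C) C := by
  intro S hS hAS hSC
  obtain ⟨⟨T, hT, hgen⟩, hr⟩ := h (S ⊔ A) (hS.sup hA) le_sup_right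
    (sup_le (hSC.trans le_sup_right) le_sup_left)
  have hdec : ∀ t ∈ T, ∃ s ∈ S, ∃ b ∈ A, s + b = t := fun t ht => Submodule.mem_sup.1 (hT ht)
  classical
  choose! s hs b hb hsb using hdec
  refine ⟨⟨T.image s, ?_, ?_⟩, ?_⟩
  · intro x hx
    obtain ⟨t, ht, rfl⟩ := Finset.mem_image.1 hx
    exact hs t ht
  · intro W hW hAW hTW
    have h2 : S ⊔ A ≤ (W ⊓ S) ⊔ A := by
      apply hgen _ ((hW.inf hS).sup hA) le_sup_right
      intro t ht
      rw [← hsb t ht]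
      exact Submodule.add_mem_sup ⟨hTW (Finset.mem_image_of_mem s ht), hs t ht⟩ (hb t ht)
    intro x hx
    obtain ⟨w, hw, a, ha, rfl⟩ := Submodule.mem_sup.1 (h2 (Submodule.mem_sup_left hx))
    refine W.add_mem hw.1 (hAW ⟨ha, hSC ?_⟩)
    exact (Submodule.add_mem_iff_right _ hw.2).1 hx
  · have h1 := hL.hilb_sup_add_hilb_inf (hS 0) (hA 0)
    have h2 : S ⊓ A = A ⊓ C := by
      apply le_antisymm
      · exact le_inf inf_le_right (inf_le_left.trans hSC)
      · exact le_inf hAS inf_le_left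
    rw [h2] at h1
    convert hr using 1
    rw [eq_sub_iff_add_eq.2 h1]
    ring

/-- The interval of a quotient, seen in the total space. -/
theorem GoodInt.ker_top [CharZero k] {L' : ℕ → Module.End k Y} (hL : IsGrading (L 0))
    (π : X →ₗ[k] Y) (hπ : ∀ m x, π (L m x) = L' m (π x))
    (h : GoodInt L' ⊥ ⊤) : GoodInt L (LinearMap.ker π) ⊤ := by
  intro S hS hker _
  obtain ⟨⟨T, hT, hgen⟩, hr⟩ := h (S.map π) (hS.map π hπ) bot_le le_top
  have hdec : ∀ t ∈ T, ∃ s ∈ S, π s = t := fun t ht => hT ht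
  classical
  choose! s hs hst using hdec
  refine ⟨⟨T.image s, ?_, ?_⟩, ?_⟩
  · intro x hx
    obtain ⟨t, ht, rfl⟩ := Finset.mem_image.1 hx
    exact hs t ht
  · intro W hW hAW hTW
    have := hgen (W.map π) (hW.map π hπ) bot_le (by
      intro t ht
      exact ⟨s t, hTW (Finset.mem_image_of_mem s ht), hst t ht⟩)
    rw [Submodule.map_le_iff_le_comap, Submodule.comap_map_eq, sup_eq_left.2 hAW] at this
    exact this
  · have h1 := hL.hilb_map π (hπ 0) (hS 0)
    rw [inf_eq_right.2 hker] at h1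
    have h0 : hilb (L' 0) ⊥ = 0 := by
      ext d
      simp [hilb]
    rw [h0, sub_zero] at hr
    rw [← h1, add_sub_cancel_right]
    exact hr

/-- A quotient of a good space is good. -/
theorem GoodInt.map_surjective [CharZero k] {L' : ℕ → Module.End k Y} (hL : IsGrading (L 0))
    (π : X →ₗ[k] Y) (hπ : ∀ m x, π (L m x) = L' m (π x)) (hsurj : Function.Surjective π)
    (h : GoodInt L ⊥ ⊤) : GoodInt L' ⊥ ⊤ := by
  have hk : OpClosed L (LinearMap.ker π) := by
    intro m x hx
    rw [LinearMap.mem_ker] at *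
    rw [hπ, hx, map_zero]
  have h' := h.mono hk bot_le le_top le_rfl
  intro S hS _ _
  have hker : LinearMap.ker π ≤ S.comap π := LinearMap.ker_le_comap _
  have hmap : (S.comap π).map π = S := Submodule.map_comap_eq_of_surjective hsurj S
  obtain ⟨⟨T, hT, hgen⟩, hr⟩ := h' (S.comap π) (hS.comap π hπ) hker le_top
  classical
  refine ⟨⟨T.image π, ?_, ?_⟩, ?_⟩
  · intro x hx
    obtain ⟨t, ht, rfl⟩ := Finset.mem_image.1 hx
    exact hT ht
  · intro W hW _ hTW
    have := hgen (W.comap π) (hW.comap π hπ) (LinearMap.ker_le_comap _) (by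
      intro t ht
      exact hTW (Finset.mem_image_of_mem π ht))
    rw [← hmap]
    exact Submodule.map_le_iff_le_comap.2 this
  · have h1 := hL.hilb_map π (hπ 0) ((hS.comap π hπ) 0)
    rw [inf_eq_right.2 hker, hmap] at h1
    have h0 : hilb (L' 0) ⊥ = 0 := by
      ext d
      simp [hilb]
    rw [← h1, add_sub_cancel_right] at hr
    rw [h0, sub_zero]
    exact hr

theorem GoodInt.map_injective [CharZero k] {L' : ℕ → Module.End k Y} (hL : IsGrading (L 0))
    (ψ : X →ₗ[k] Y) (hψ : ∀ m x, ψ (L m x) = L' m (ψ x)) (hinj : Function.Injective ψ)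
    (hA : OpClosed L A)
    (h : GoodInt L A ⊤) : GoodInt L' (A.map ψ) (LinearMap.range ψ) := by
  intro S hS hAS hSr
  have hmap : (S.comap ψ).map ψ = S := by
    rw [Submodule.map_comap_eq, inf_eq_right.2 hSr]
  obtain ⟨⟨T, hT, hgen⟩, hr⟩ := h (S.comap ψ) (hS.comap ψ hψ)
    (Submodule.map_le_iff_le_comap.1 hAS) le_top
  classical
  refine ⟨⟨T.image ψ, ?_, ?_⟩, ?_⟩
  · intro x hx
    obtain ⟨t, ht, rfl⟩ := Finset.mem_image.1 hx
    exact hT ht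
  · intro W hW hAW hTW
    have := hgen (W.comap ψ) (hW.comap ψ hψ) (Submodule.map_le_iff_le_comap.1 hAW) (by
      intro t ht
      exact hTW (Finset.mem_image_of_mem ψ ht))
    rw [← hmap]
    exact Submodule.map_le_iff_le_comap.2 this
  · have h1 := hL.hilb_map ψ (hψ 0) ((hS.comap ψ hψ) 0)
    have h2 := hL.hilb_map ψ (hψ 0) (hA 0)
    have h0 : hilb (L 0) (⊥ : Submodule k X) = 0 := by
      ext d
      simp [hilb]
    rw [LinearMap.ker_eq_bot.2 hinj, inf_bot_eq, h0, add_zero] at h1 h2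
    rw [hmap] at h1
    rw [h1, h2]
    exact hr

/-- The coefficients of a polynomial map with values in a subspace at sufficiently many points
belong to that subspace. -/
theorem coeff_mem_of_values_mem {S : Submodule k X} (d : ℕ) (v : ℕ → X) (F : Finset k)
    (hF : d < F.card) (h : ∀ t ∈ F, ∑ j ∈ Finset.range (d + 1), t ^ j • v j ∈ S)
    {j : ℕ} (hj : j ≤ d) : v j ∈ S := by
  -- A functional that kills `S` but not `v j` would give a nonzero scalar polynomial with more
  -- roots than its degree.
  by_contra hv
  obtain ⟨φ, hφ, hφS⟩ := Submodule.exists_le_ker_of_notMem hv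
  let p : Polynomial k := ∑ j ∈ Finset.range (d + 1), Polynomial.monomial j (φ (v j))
  have hdeg : p.natDegree < F.card := by
    refine lt_of_le_of_lt ?_ hF
    refine Polynomial.natDegree_sum_le_of_forall_le _ _ fun i hi => ?_
    exact (Polynomial.natDegree_monomial_le _).trans (Nat.lt_succ_iff.1 (Finset.mem_range.1 hi))
  have hp : p = 0 := by
    refine Polynomial.eq_zero_of_natDegree_lt_card_of_eval_eq_zero' p F (fun t ht => ?_) hdeg
    have := hφS (h t ht)
    rw [LinearMap.mem_ker, map_sum] at this
    rw [Polynomial.eval_finsetSum, ← this]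
    refine Finset.sum_congr rfl fun i _ => ?_
    rw [Polynomial.eval_monomial, map_smul, smul_eq_mul, mul_comm]
  have hc : p.coeff j = φ (v j) := by
    simp only [p, Polynomial.finsetSum_coeff, Polynomial.coeff_monomial]
    rw [Finset.sum_ite_eq']
    simp [Nat.lt_succ_iff.2 hj]
  rw [hp, Polynomial.coeff_zero] at hc
  exact hφ hc.symm

end Interval

theorem GoodInt.refl {k X : Type*} [Field k] [AddCommGroup X] [Module k X]
    {L : ℕ → Module.End k X} (A : Submodule k X) : GoodInt L A A := by
  intro S _ hAS hSA
  obtain rfl := le_antisymm hAS hSA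
  refine ⟨⟨∅, by simp, fun W _ h _ => h⟩, ?_⟩
  rw [sub_self]
  exact .zero

open MvPolynomial

/-! ### Density operators and filtrations by powers of linear forms -/

section Operators

variable {k : Type*} [Field k] {n : ℕ}

/-- The vector field `∑ xᵢ^(m+1) ∂ᵢ`. -/
noncomputable def vf (k : Type*) [Field k] (n m : ℕ) :
    Derivation k (MvPolynomial (Fin n) k) (MvPolynomial (Fin n) k) :=
  mkDerivation k fun i => X i ^ (m + 1)

/-- The multiplication part of the action of a vector field on tensor densities. -/
noncomputable def pot (k : Type*) [Field k] {n : ℕ} (w : Fin n → ℕ) (v m : ℕ) :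
    MvPolynomial (Fin n) k :=
  ∑ i, C (((m : k) + 1) * w i) * X i ^ m + if m = 0 then C (v : k) else 0

/-- The action of `x^(m+1) d/dx` on tensor densities of weight `w i` in the variable `xᵢ`, with
grading shifted by `v`. -/
noncomputable def densityOp (k : Type*) [Field k] {n : ℕ} (w : Fin n → ℕ) (v m : ℕ) :
    Module.End k (MvPolynomial (Fin n) k) :=
  (vf k n m).toLinearMap + LinearMap.mulLeft k (pot k w v m)

@[simp] theorem vf_X (m : ℕ) (i : Fin n) : vf k n m (X i) = X i ^ (m + 1) :=
  mkDerivation_X _ _ _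

theorem densityOp_apply (w : Fin n → ℕ) (v m : ℕ) (f : MvPolynomial (Fin n) k) :
    densityOp k w v m f = vf k n m f + pot k w v m * f := rfl

theorem densityOp_mul (w : Fin n → ℕ) (v m : ℕ) (g f : MvPolynomial (Fin n) k) :
    densityOp k w v m (g * f) = vf k n m g * f + g * densityOp k w v m f := by
  simp only [densityOp_apply, Derivation.leibniz, smul_eq_mul]
  ring

theorem vf_eq_sum (m : ℕ) (f : MvPolynomial (Fin n) k) :
    vf k n m f = ∑ i, X i ^ m * (X i * pderiv i f) := by
  induction f using MvPolynomial.induction_on with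
  | C a => simp [← algebraMap_eq]
  | add p q hp hq => simp only [map_add, hp, hq, mul_add, Finset.sum_add_distrib]
  | mul_X p j hp =>
    simp only [Derivation.leibniz, smul_eq_mul, vf_X, hp, mul_add, Finset.sum_add_distrib]
    congr 1
    · rw [Finset.sum_eq_single j]
      · rw [pderiv_X_self]; ring
      · intro i _ hij
        rw [pderiv_X_of_ne hij.symm]; ring
      · simp
    · rw [Finset.mul_sum]
      exact Finset.sum_congr rfl fun i _ => by ring

theorem X_mul_pderiv_monomial_eq (i : Fin n) (a : Fin n →₀ ℕ) (r : k) :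
    (X i * pderiv i (monomial a r) : MvPolynomial (Fin n) k) = (a i : k) • monomial a r := by
  rw [X_mul_pderiv_monomial, Nat.cast_smul_eq_nsmul]

theorem densityOp_zero_monomial (w : Fin n → ℕ) (v : ℕ) (a : Fin n →₀ ℕ) (r : k) :
    densityOp k w v 0 (monomial a r) = ((a.degree + ∑ i, w i + v : ℕ) : k) • monomial a r := by
  rw [densityOp_apply, vf_eq_sum, pot, if_pos rfl]
  simp only [X_mul_pderiv_monomial_eq, pow_zero, one_mul, mul_one, ← Finset.sum_smul]
  rw [smul_eq_C_mul, smul_eq_C_mul, ← add_mul]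
  congr 1
  rw [Finsupp.degree_eq_sum]
  simp only [Nat.cast_zero, zero_add, one_mul, Nat.cast_add, Nat.cast_sum, map_add, map_sum]
  ring

theorem coeff_densityOp_zero (w : Fin n → ℕ) (v : ℕ) (a : Fin n →₀ ℕ)
    (f : MvPolynomial (Fin n) k) :
    coeff a (densityOp k w v 0 f) = ((a.degree + ∑ i, w i + v : ℕ) : k) * coeff a f := by
  induction f using MvPolynomial.induction_on' with
  | monomial b r =>
    rw [densityOp_zero_monomial, coeff_smul, smul_eq_mul, coeff_monomial]
    split_ifs with h
    · rw [h]
    · simp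
  | add p q hp hq => rw [map_add, coeff_add, coeff_add, hp, hq, mul_add]

theorem eigenspace_densityOp_zero_le [CharZero k] (w : Fin n → ℕ) (v d : ℕ) :
    (densityOp k w v 0).eigenspace (d : k) ≤
      homogeneousSubmodule (Fin n) k (d - (∑ i, w i + v)) := by
  intro f hf a ha
  have h := congrArg (coeff a) (Module.End.mem_eigenspace_iff.1 hf)
  rw [coeff_densityOp_zero, coeff_smul, smul_eq_mul] at h
  have h := Nat.cast_injective (mul_right_cancel₀ ha h)
  change Finsupp.weight (fun _ => 1) a = _
  rw [← Finsupp.degree_eq_weight_one]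
  omega

theorem isGrading_densityOp [CharZero k] (w : Fin n → ℕ) (v : ℕ) :
    IsGrading (densityOp k w v 0) := by
  constructor
  · rw [eq_top_iff]
    rintro f -
    rw [f.as_sum]
    refine Submodule.sum_mem _ fun a _ => ?_
    refine Submodule.mem_iSup_of_mem (a.degree + ∑ i, w i + v) ?_
    rw [Module.End.mem_eigenspace_iff, densityOp_zero_monomial]
  · intro d
    have : FiniteDimensional k (homogeneousSubmodule (Fin n) k (d - (∑ i, w i + v))) :=
      Module.Finite.iff_fg.2 (homogeneousSubmodule_fg _ _ _)
    exact Submodule.finiteDimensional_of_le (eigenspace_densityOp_zero_le w v d)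

/-- The multiples of a polynomial. -/
noncomputable def multiples (q : MvPolynomial (Fin n) k) : Submodule k (MvPolynomial (Fin n) k) :=
  LinearMap.range (LinearMap.mulLeft k q)

theorem mem_multiples {q f : MvPolynomial (Fin n) k} : f ∈ multiples q ↔ q ∣ f := by
  constructor
  · rintro ⟨g, rfl⟩
    exact ⟨g, rfl⟩
  · rintro ⟨g, rfl⟩
    exact ⟨g, rfl⟩

theorem opClosed_multiples {q : MvPolynomial (Fin n) k} (hq : ∀ m, q ∣ vf k n m q)
    (w : Fin n → ℕ) (v : ℕ) : OpClosed (densityOp k w v) (multiples q) := by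
  intro m f hf
  rw [mem_multiples] at *
  obtain ⟨g, rfl⟩ := hf
  rw [densityOp_mul]
  exact dvd_add (Dvd.dvd.mul_right (hq m) _) (Dvd.intro _ rfl)

theorem dvd_vf_mul {p q : MvPolynomial (Fin n) k} {m : ℕ} (hp : p ∣ vf k n m p)
    (hq : q ∣ vf k n m q) : p * q ∣ vf k n m (p * q) := by
  rw [Derivation.leibniz, smul_eq_mul, smul_eq_mul]
  exact dvd_add (mul_dvd_mul_left _ hq) (by rw [mul_comm q]; exact mul_dvd_mul_right hp _)

theorem dvd_vf_prod {ι : Type*} (s : Finset ι) (p : ι → MvPolynomial (Fin n) k) {m : ℕ}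
    (h : ∀ i ∈ s, p i ∣ vf k n m (p i)) : (∏ i ∈ s, p i) ∣ vf k n m (∏ i ∈ s, p i) := by
  classical
  induction s using Finset.induction_on with
  | empty => simp
  | insert a s ha ih =>
    rw [Finset.prod_insert ha]
    exact dvd_vf_mul (h _ (Finset.mem_insert_self _ _))
      (ih fun i hi => h i (Finset.mem_insert_of_mem hi))

theorem dvd_vf_pow {p : MvPolynomial (Fin n) k} {m : ℕ} (hp : p ∣ vf k n m p) (j : ℕ) :
    p ^ j ∣ vf k n m (p ^ j) := by
  have := dvd_vf_prod (Finset.range j) (fun _ => p) (m := m) fun _ _ => hp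
  simpa using this

/-- The form `l` divides its image under all vector fields, and the quotients of successive powers
of `l` are good. -/
structure GoodForm (l : MvPolynomial (Fin n) k) : Prop where
  dvd_vf : ∀ m, l ∣ vf k n m l
  good : ∀ (w : Fin n → ℕ) (v j : ℕ),
    GoodInt (densityOp k w v) (multiples (l ^ (j + 1))) (multiples (l ^ j))

theorem GoodForm.good_pow [CharZero k] {l : MvPolynomial (Fin n) k} (hl : GoodForm l)
    (w : Fin n → ℕ) (v j : ℕ) : GoodInt (densityOp k w v) (multiples (l ^ j)) ⊤ := by
  induction j with
  | zero =>
    have : multiples (l ^ 0) = ⊤ := by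
      rw [eq_top_iff]
      intro f _
      simp [mem_multiples]
    rw [this]
    exact .refl _
  | succ j ih =>
    refine GoodInt.trans (isGrading_densityOp w v)
      (opClosed_multiples (fun m => dvd_vf_pow (hl.dvd_vf m) j) w v) ?_ le_top (hl.good w v j) ih
    intro f hf
    rw [mem_multiples] at *
    exact (pow_dvd_pow l j.le_succ).trans hf

/-- For relatively prime factors the multiples of the product form an intersection, so each new
factor contributes a quotient controlled by `GoodInt.inf_of_sup`. -/
theorem good_multiples_prod [CharZero k] {ι : Type*} (s : Finset ι)
    (l : ι → MvPolynomial (Fin n) k) (hl : ∀ i ∈ s, GoodForm (l i))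
    (hrel : (s : Set ι).Pairwise fun i j => IsRelPrime (l i) (l j))
    (w : Fin n → ℕ) (v J : ℕ) :
    GoodInt (densityOp k w v) (multiples ((∏ i ∈ s, l i) ^ J)) ⊤ := by
  classical
  induction s using Finset.induction_on with
  | empty =>
    have : multiples ((∏ i ∈ (∅ : Finset ι), l i) ^ J) = ⊤ := by
      rw [eq_top_iff]
      intro f _
      simp [mem_multiples]
    rw [this]
    exact .refl _
  | insert a s ha ih =>
    have ih := ih (fun i hi => hl i (Finset.mem_insert_of_mem hi))
      (hrel.mono (Finset.coe_subset.2 (Finset.subset_insert a s)))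
    have hla := hl a (Finset.mem_insert_self _ _)
    have hc1 := opClosed_multiples (fun m => dvd_vf_pow (hla.dvd_vf m) J) w v
    have hc2 := opClosed_multiples (fun m => dvd_vf_pow (dvd_vf_prod s l (m := m)
      fun i hi => (hl i (Finset.mem_insert_of_mem hi)).dvd_vf m) J) w v
    have hrp : IsRelPrime (l a ^ J) ((∏ i ∈ s, l i) ^ J) := by
      refine IsRelPrime.pow (IsRelPrime.prod_right fun i hi => ?_)
      exact hrel (Finset.mem_insert_self _ _) (Finset.mem_insert_of_mem hi)
        (by rintro rfl; exact ha hi)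
    have heq : multiples ((∏ i ∈ insert a s, l i) ^ J) =
        multiples (l a ^ J) ⊓ multiples ((∏ i ∈ s, l i) ^ J) := by
      ext f
      rw [Submodule.mem_inf, mem_multiples, mem_multiples, mem_multiples,
        Finset.prod_insert ha, mul_pow]
      exact ⟨fun h => ⟨(Dvd.intro _ rfl).trans h, (Dvd.intro_left _ rfl).trans h⟩,
        fun h => hrp.mul_dvd h.1 h.2⟩
    rw [heq]
    refine GoodInt.trans (isGrading_densityOp w v) hc2 inf_le_right le_top ?_ ih
    refine GoodInt.inf_of_sup (isGrading_densityOp w v) hc1 ?_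
    exact (hla.good_pow w v J).mono hc1 le_rfl le_top le_top

end Operators

/-! ### Restriction to hyperplanes and reduction of weight one -/

section Restriction

variable {k : Type*} [Field k] {n : ℕ}

/-- Restriction to the hyperplane `xᵢ = y`. -/
noncomputable def restrict (i : Fin (n + 1)) (y : MvPolynomial (Fin n) k) :
    MvPolynomial (Fin (n + 1)) k →ₐ[k] MvPolynomial (Fin n) k :=
  aeval (i.insertNth y X)

@[simp] theorem restrict_X_self (i : Fin (n + 1)) (y : MvPolynomial (Fin n) k) :
    restrict i y (X i) = y := by
  simp [restrict]

@[simp] theorem restrict_X_succAbove (i : Fin (n + 1)) (y : MvPolynomial (Fin n) k) (j : Fin n) :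
    restrict i y (X (i.succAbove j)) = X j := by
  simp [restrict]

@[simp] theorem restrict_rename (i : Fin (n + 1)) (y f : MvPolynomial (Fin n) k) :
    restrict i y (rename i.succAbove f) = f := by
  have : (restrict i y).comp (rename i.succAbove) = AlgHom.id k _ := by
    ext j
    simp
  exact DFunLike.congr_fun this f

theorem dvd_sub_rename_restrict (i : Fin (n + 1)) (y : MvPolynomial (Fin n) k)
    (f : MvPolynomial (Fin (n + 1)) k) :
    X i - rename i.succAbove y ∣ f - rename i.succAbove (restrict i y f) := by
  rw [← Ideal.mem_span_singleton, ← Ideal.Quotient.eq]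
  have : (Ideal.Quotient.mkₐ k (Ideal.span {X i - rename i.succAbove y})) =
      (Ideal.Quotient.mkₐ k (Ideal.span {X i - rename i.succAbove y})).comp
        ((rename i.succAbove).comp (restrict i y)) := by
    refine MvPolynomial.algHom_ext fun j => ?_
    rcases Fin.eq_self_or_eq_succAbove i j with rfl | ⟨j, rfl⟩
    · simp only [AlgHom.comp_apply, restrict_X_self, Ideal.Quotient.mkₐ_eq_mk]
      rw [Ideal.Quotient.eq, Ideal.mem_span_singleton]
    · simp
  exact DFunLike.congr_fun this f

theorem restrict_eq_zero_iff (i : Fin (n + 1)) (y : MvPolynomial (Fin n) k)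
    (f : MvPolynomial (Fin (n + 1)) k) :
    restrict i y f = 0 ↔ X i - rename i.succAbove y ∣ f := by
  constructor
  · intro h
    have := dvd_sub_rename_restrict i y f
    rwa [h, map_zero, sub_zero] at this
  · rintro ⟨g, rfl⟩
    simp

theorem restrict_vf (i : Fin (n + 1)) (y : MvPolynomial (Fin n) k) (m : ℕ)
    (hy : vf k n m y = y ^ (m + 1)) (f : MvPolynomial (Fin (n + 1)) k) :
    restrict i y (vf k (n + 1) m f) = vf k n m (restrict i y f) := by
  induction f using MvPolynomial.induction_on with
  | C a => simp [← algebraMap_eq]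
  | add p q hp hq => simp [hp, hq]
  | mul_X p j hp =>
    rw [Derivation.leibniz, smul_eq_mul, smul_eq_mul, map_add, map_mul, map_mul, hp, map_mul,
      Derivation.leibniz, smul_eq_mul, smul_eq_mul, vf_X, map_pow]
    congr 2
    rcases Fin.eq_self_or_eq_succAbove i j with rfl | ⟨j, rfl⟩
    · simp [hy]
    · simp

theorem rename_vf (i : Fin (n + 1)) (m : ℕ) (f : MvPolynomial (Fin n) k) :
    rename i.succAbove (vf k n m f) = vf k (n + 1) m (rename i.succAbove f) := by
  induction f using MvPolynomial.induction_on with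
  | C a => simp [← algebraMap_eq]
  | add p q hp hq => simp [hp, hq]
  | mul_X p j hp =>
    rw [Derivation.leibniz, smul_eq_mul, smul_eq_mul, map_add, map_mul, map_mul, hp, map_mul,
      Derivation.leibniz, smul_eq_mul, smul_eq_mul, vf_X, map_pow, rename_X, vf_X]

/-- The quotient of `vf m` of the form `xᵢ - y` by that form. -/
noncomputable def formQuot (i : Fin (n + 1)) (y : MvPolynomial (Fin n) k) (m : ℕ) :
    MvPolynomial (Fin (n + 1)) k :=
  ∑ t ∈ Finset.range (m + 1), X i ^ t * rename i.succAbove y ^ (m - t)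

theorem vf_form (i : Fin (n + 1)) (y : MvPolynomial (Fin n) k) (m : ℕ)
    (hy : vf k n m y = y ^ (m + 1)) :
    vf k (n + 1) m (X i - rename i.succAbove y) =
      (X i - rename i.succAbove y) * formQuot i y m := by
  rw [map_sub, vf_X, ← rename_vf, hy, map_pow, formQuot]
  rw [← (Commute.all (X i) (rename i.succAbove y)).mul_geom_sum₂ (m + 1)]
  simp

theorem restrict_formQuot (i : Fin (n + 1)) (y : MvPolynomial (Fin n) k) (m : ℕ) :
    restrict i y (formQuot i y m) = ((m : MvPolynomial (Fin n) k) + 1) * y ^ m := by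
  rw [formQuot, map_sum]
  rw [Finset.sum_congr rfl (g := fun _ => y ^ m)]
  · simp
  · intro t ht
    rw [map_mul, map_pow, map_pow, restrict_X_self, restrict_rename, ← pow_add]
    congr 1
    have := Finset.mem_range.1 ht
    omega

/-- By the Leibniz rule, multiplication by `l ^ j` intertwines the density operators with their
twists by `j` times `vf l / l`. Restriction to `l = 0` has the multiples of `l` as kernel, and
`hpot` says that the restricted twist is again a density action. -/
theorem goodForm_of_restrict [CharZero k] (i : Fin (n + 1)) (y : MvPolynomial (Fin n) k)
    (hy : ∀ m, vf k n m y = y ^ (m + 1))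
    (hpot : ∀ (w : Fin (n + 1) → ℕ) (v j : ℕ), ∃ (w' : Fin n → ℕ) (v' : ℕ), ∀ m,
      restrict i y (pot k w v m) + (j : MvPolynomial (Fin n) k) * ((m + 1) * y ^ m) = pot k w' v' m)
    (hA : ∀ (w : Fin n → ℕ) (v : ℕ), GoodInt (densityOp k w v) ⊥ ⊤) :
    GoodForm (X i - rename i.succAbove y) := by
  set l := X i - rename i.succAbove y with hl
  have hl0 : l ≠ 0 := by
    intro h0
    -- Substituting `y + 1` for `xᵢ` sends `l` to `1`.
    have h1 : restrict i (y + 1) l = 0 := by rw [h0, map_zero]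
    rw [hl, map_sub, restrict_X_self, restrict_rename, add_sub_cancel_left] at h1
    exact one_ne_zero h1
  refine ⟨fun m => ⟨_, vf_form i y m (hy m)⟩, fun w v j => ?_⟩
  obtain ⟨w', v', hw'⟩ := hpot w v j
  let Z : ℕ → Module.End k (MvPolynomial (Fin (n + 1)) k) := fun m =>
    densityOp k w v m + LinearMap.mulLeft k ((j : MvPolynomial (Fin (n + 1)) k) * formQuot i y m)
  -- For `m = 0` the quotient `formQuot` is `1`, so the twist only shifts the grading.
  have hZ0 : Z 0 = densityOp k w (v + j) 0 := by
    refine LinearMap.ext fun f => ?_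
    simp only [Z, LinearMap.add_apply, densityOp_apply, pot, formQuot, LinearMap.mulLeft_apply]
    simp
    ring
  have hgr : IsGrading (Z 0) := by
    rw [hZ0]
    exact isGrading_densityOp _ _
  have hρ : ∀ m f, (restrict i y).toLinearMap (Z m f) =
      densityOp k w' v' m ((restrict i y).toLinearMap f) := by
    intro m f
    simp only [Z, LinearMap.add_apply, densityOp_apply, LinearMap.mulLeft_apply,
      AlgHom.toLinearMap_apply, map_add, map_mul, restrict_vf i y m (hy m), ← hw',
      restrict_formQuot, map_natCast]
    ring
  have hψ : ∀ m f, LinearMap.mulLeft k (l ^ j) (Z m f) =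
      densityOp k w v m (LinearMap.mulLeft k (l ^ j) f) := by
    intro m f
    simp only [LinearMap.mulLeft_apply, densityOp_mul, Z, LinearMap.add_apply]
    rw [Derivation.leibniz_pow, vf_form i y m (hy m), ← hl, smul_eq_mul]
    rcases j with _ | j
    · simp
    · simp only [Nat.add_sub_cancel, nsmul_eq_mul]
      ring
  have h1 := GoodInt.ker_top hgr (restrict i y).toLinearMap hρ (hA w' v')
  have hker : OpClosed Z (LinearMap.ker (restrict i y).toLinearMap) := by
    rw [← Submodule.comap_bot]
    exact OpClosed.comap _ hρ OpClosed.bot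
  have h2 := GoodInt.map_injective hgr (LinearMap.mulLeft k (l ^ j)) hψ
    (fun _ _ h => mul_left_cancel₀ (pow_ne_zero j hl0) h) hker h1
  have heq : (LinearMap.ker (restrict i y).toLinearMap).map (LinearMap.mulLeft k (l ^ j)) =
      multiples (l ^ (j + 1)) := by
    ext f
    rw [mem_multiples]
    constructor
    · rintro ⟨g, hg, rfl⟩
      obtain ⟨h, rfl⟩ := (restrict_eq_zero_iff i y g).1 hg
      exact ⟨h, by rw [LinearMap.mulLeft_apply, pow_succ, mul_assoc]⟩
    · rintro ⟨h, rfl⟩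
      refine ⟨l * h, ?_, by rw [LinearMap.mulLeft_apply, pow_succ, mul_assoc]⟩
      exact (restrict_eq_zero_iff i y _).2 (Dvd.intro _ rfl)
  rw [heq] at h2
  exact h2

/-- On `xᵢ = 0` the potential of `xᵢ` and the twist survive only for `m = 0`, as the constant `w i +
j`. This is why the shift `v` must be carried along. -/
theorem goodForm_X [CharZero k] (i : Fin (n + 1))
    (hA : ∀ (w : Fin n → ℕ) (v : ℕ), GoodInt (densityOp k w v) ⊥ ⊤) :
    GoodForm (X i : MvPolynomial (Fin (n + 1)) k) := by
  have := goodForm_of_restrict (k := k) i 0 (fun m => by simp) (fun w v j =>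
    ⟨fun t => w (i.succAbove t), v + w i + j, fun m => ?_⟩) hA
  · simpa using this
  · rw [pot, Fin.sum_univ_succAbove _ i]
    rcases m with _ | m
    · simp [pot]
      ring
    · simp [pot]

/-- On the diagonal the two weights and the order of vanishing add up to the weight of the merged
variable. -/
theorem goodForm_X_sub_X [CharZero k] {i j : Fin (n + 1)} (hij : i ≠ j)
    (hA : ∀ (w : Fin n → ℕ) (v : ℕ), GoodInt (densityOp k w v) ⊥ ⊤) :
    GoodForm (X i - X j : MvPolynomial (Fin (n + 1)) k) := by
  obtain ⟨t, rfl⟩ := Fin.exists_succAbove_eq hij.symm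
  have := goodForm_of_restrict (k := k) i (X t) (fun m => by simp) (fun w v j =>
    ⟨fun s => w (i.succAbove s) + if s = t then w i + j else 0, v, fun m => ?_⟩) hA
  · simpa using this
  · rw [pot, Fin.sum_univ_succAbove _ i, pot]
    have : ∀ s, (C (((m : k) + 1) * ((w (i.succAbove s) + if s = t then w i + j else 0 : ℕ) : k)) *
        X s ^ m : MvPolynomial (Fin n) k) = C (((m : k) + 1) * (w (i.succAbove s) : k)) * X s ^ m +
          if s = t then C (((m : k) + 1) * (w i + j : k)) * X t ^ m else 0 := by
      intro s
      split_ifs with h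
      · subst h
        push_cast
        simp only [map_add, map_mul]
        ring
      · simp
    simp only [this, Finset.sum_add_distrib, Finset.sum_ite_eq', Finset.mem_univ, if_true]
    split_ifs <;> simp <;> ring

/-- Differentiation maps functions to densities of weight one. -/
theorem good_of_weight_one [CharZero k] {w : Fin n → ℕ} {i : Fin n} (hi : w i = 1) {v : ℕ}
    (h : GoodInt (densityOp k (Function.update w i 0) v) ⊥ ⊤) :
    GoodInt (densityOp k w v) ⊥ ⊤ := by
  refine GoodInt.map_surjective (isGrading_densityOp _ v) (pderiv i).toLinearMap ?_ ?_ h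
  · intro m f
    -- The commutator is exactly the potential of one unit of weight at `xᵢ`.
    have hvf : pderiv i (vf k n m f) = vf k n m (pderiv i f) +
        C ((m : k) + 1) * X i ^ m * pderiv i f := by
      induction f using MvPolynomial.induction_on with
      | C a => simp [← algebraMap_eq]
      | add p q hp hq => simp only [map_add, hp, hq]; ring
      | mul_X p j hp =>
        simp only [Derivation.leibniz, smul_eq_mul, map_add, vf_X, hp]
        rw [pderiv_X]
        by_cases hj : i = j
        · subst hj
          rw [Pi.single_eq_same]
          simp
          ring
        · rw [Pi.single_eq_of_ne (Ne.symm hj)]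
          simp [hj]
          ring
    have hpot : pot k w v m = pot k (Function.update w i 0) v m + C ((m : k) + 1) * X i ^ m := by
      rw [pot, pot, ← Finset.add_sum_erase _ _ (Finset.mem_univ i),
        ← Finset.add_sum_erase (a := i) _ (fun j => C (((m : k) + 1) *
          (Function.update w i 0 j : ℕ)) * X j ^ m) (Finset.mem_univ i)]
      rw [Finset.sum_congr rfl (g := fun j => C (((m : k) + 1) *
          (Function.update w i 0 j : ℕ)) * X j ^ m) (s₁ := Finset.univ.erase i)]
      · rw [hi]; simp; ring
      · intro j hj
        rw [Function.update_of_ne (Finset.ne_of_mem_erase hj)]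
    have hp0 : pderiv i (pot k (Function.update w i 0) v m) = 0 := by
      rw [pot, map_add, map_sum]
      rw [Finset.sum_eq_zero]
      · split_ifs <;> simp
      · intro j _
        by_cases hj : j = i
        · subst hj; simp
        · rw [Derivation.leibniz, Derivation.leibniz_pow, pderiv_X_of_ne hj]
          simp
    simp only [Derivation.coeFn_coe, densityOp_apply, map_add, hvf,
      Derivation.leibniz, hp0, smul_eq_mul, hpot]
    ring
  · intro f
    induction f using MvPolynomial.induction_on' with
    | monomial a r =>
      refine ⟨monomial (a + Finsupp.single i 1) (r / (a i + 1)), ?_⟩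
      have : ((a i : k) + 1) ≠ 0 := Nat.cast_add_one_ne_zero _
      simp [pderiv_monomial]
      field_simp
    | add p q hp hq =>
      obtain ⟨p', rfl⟩ := hp
      obtain ⟨q', rfl⟩ := hq
      exact ⟨p' + q', map_add _ _ _⟩

end Restriction

/-! ### Polarization: isolating terms with one operator per variable -/

section Polarization

variable {k : Type*} [Field k] {n r : ℕ}

/-- The summand of `densityOp` that acts on the variable `xᵢ`. -/
noncomputable def localOp (k : Type*) [Field k] {n : ℕ} (w : Fin n → ℕ) (i : Fin n) (m : ℕ) :
    Module.End k (MvPolynomial (Fin n) k) :=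
  LinearMap.mulLeft k (X i ^ m) ∘ₗ
    (LinearMap.mulLeft k (X i) ∘ₗ (pderiv i).toLinearMap + (((m : k) + 1) * w i) • LinearMap.id)

theorem localOp_monomial (w : Fin n → ℕ) (i : Fin n) (m : ℕ) (a : Fin n →₀ ℕ) (s : k) :
    localOp k w i m (monomial a s) =
      ((a i : k) + (m + 1) * w i) • monomial (a + Finsupp.single i m) s := by
  have h := X_mul_pderiv_monomial_eq i a s
  simp only [localOp, LinearMap.comp_apply, LinearMap.add_apply, LinearMap.mulLeft_apply,
    Derivation.coeFn_coe, LinearMap.smul_apply, LinearMap.id_apply]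
  rw [h, ← add_smul, mul_smul_comm, X_pow_eq_monomial, monomial_mul, one_mul, add_comm a]

theorem densityOp_eq_sum_localOp (w : Fin n → ℕ) (v : ℕ) {m : ℕ} (hm : m ≠ 0) :
    densityOp k w v m = ∑ i, localOp k w i m := by
  refine LinearMap.ext fun f => ?_
  rw [densityOp_apply, vf_eq_sum, pot, if_neg hm, add_zero, Finset.sum_mul,
    ← Finset.sum_add_distrib, LinearMap.sum_apply]
  refine Finset.sum_congr rfl fun i _ => ?_
  simp only [localOp, LinearMap.comp_apply, LinearMap.add_apply, LinearMap.mulLeft_apply,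
    Derivation.coeFn_coe, LinearMap.smul_apply, LinearMap.id_apply, smul_eq_C_mul]
  ring

theorem prod_ofFn_sum {R : Type*} [Semiring R] (M : Fin n → Fin r → R) :
    (List.ofFn fun l => ∑ i, M i l).prod =
      ∑ φ : Fin r → Fin n, (List.ofFn fun l => M (φ l) l).prod := by
  induction r with
  | zero => simp
  | succ r ih =>
    rw [List.ofFn_succ, List.prod_cons, ih fun i l => M i l.succ, Finset.sum_mul_sum,
      ← Fintype.sum_prod_type', ← (Fin.consEquiv fun _ => Fin n).sum_comp]
    refine Finset.sum_congr rfl fun x _ => ?_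
    simp [Fin.consEquiv, List.ofFn_succ]

/-- The scalar by which a letter acts after the later ones have acted. -/
noncomputable def letterScalar (k : Type*) [Field k] (w : Fin n → ℕ) (a : Fin n →₀ ℕ)
    (φ : Fin r → Fin n) (m : Fin r →₀ ℕ) (l : Fin r) : k :=
  ((a (φ l) : k) + w (φ l)) +
    ∑ l', ((if l' = l then (w (φ l) : k) else 0) +
      (if l < l' ∧ φ l' = φ l then 1 else 0)) * (m l' : k)

theorem letterScalar_eq (w : Fin n → ℕ) (a : Fin n →₀ ℕ)
    (φ : Fin r → Fin n) (m : Fin r →₀ ℕ) (l : Fin r) :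
    letterScalar k w a φ m l = ((a (φ l) : k) + (m l + 1) * w (φ l)) +
      ∑ l', if l < l' ∧ φ l' = φ l then (m l' : k) else 0 := by
  rw [letterScalar]
  simp only [add_mul, ite_mul, zero_mul, one_mul, Finset.sum_add_distrib, Finset.sum_ite_eq',
    Finset.mem_univ, if_true]
  ring

theorem mapDomain_apply_eq_sum {σ τ : Type*} [Fintype σ] [DecidableEq τ] (φ : σ → τ) (m : σ →₀ ℕ)
    (i : τ) : m.mapDomain φ i = ∑ l, if φ l = i then m l else 0 := by
  rw [Finsupp.mapDomain, Finsupp.sum_apply, Finsupp.sum_fintype _ _ (by simp)]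
  simp only [Finsupp.single_apply]

theorem prod_localOp_monomial (w : Fin n → ℕ) (φ : Fin r → Fin n) (m : Fin r →₀ ℕ)
    (a : Fin n →₀ ℕ) (s : k) :
    (List.ofFn fun l => localOp k w (φ l) (m l)).prod (monomial a s) =
      (∏ l, letterScalar k w a φ m l) • monomial (a + m.mapDomain φ) s := by
  induction r with
  | zero =>
    have : m = 0 := Subsingleton.elim _ _
    simp [this]
  | succ r ih =>
    have htail : ∀ l, m.tail l = m l.succ := fun l => rfl
    rw [List.ofFn_succ, List.prod_cons, Module.End.mul_apply]
    have h := ih (fun l => φ l.succ) m.tail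
    simp only [htail] at h
    rw [h, map_smul, localOp_monomial, smul_smul, Fin.prod_univ_succ]
    have hdom : m.mapDomain φ =
        Finsupp.single (φ 0) (m 0) + m.tail.mapDomain (fun l => φ l.succ) := by
      ext i
      rw [Finsupp.add_apply, mapDomain_apply_eq_sum, mapDomain_apply_eq_sum, Fin.sum_univ_succ,
        Finsupp.single_apply]
      simp only [htail]
    have hval : ((a + m.tail.mapDomain (fun l => φ l.succ)) (φ 0) : k) =
        a (φ 0) + ∑ l', if (0 : Fin (r + 1)) < l' ∧ φ l' = φ 0 then (m l' : k) else 0 := by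
      rw [Finsupp.add_apply, Nat.cast_add]
      rw [mapDomain_apply_eq_sum, Fin.sum_univ_succ]
      simp [htail]
    congr 1
    · rw [mul_comm]
      congr 1
      · rw [letterScalar_eq, hval]
        ring
      · refine Finset.prod_congr rfl fun l _ => ?_
        rw [letterScalar_eq, letterScalar_eq, Fin.sum_univ_succ]
        simp [htail]
    · rw [hdom, add_assoc, add_comm (Finsupp.single _ _)]

/-- The operator on polynomials in the letters that multiplies monomials by `letterScalar`. -/
noncomputable def letterOp (k : Type*) [Field k] (w : Fin n → ℕ) (a : Fin n →₀ ℕ)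
    (φ : Fin r → Fin n) (l : Fin r) : Module.End k (MvPolynomial (Fin r) k) :=
  ((a (φ l) : k) + w (φ l)) • LinearMap.id +
    (∑ l', ((if l' = l then (w (φ l) : k) else 0) +
      (if l < l' ∧ φ l' = φ l then 1 else 0)) •
        (LinearMap.mulLeft k (X l') ∘ₗ (pderiv l').toLinearMap))

theorem letterOp_monomial (w : Fin n → ℕ) (a : Fin n →₀ ℕ) (φ : Fin r → Fin n) (l : Fin r)
    (m : Fin r →₀ ℕ) (s : k) :
    letterOp k w a φ l (monomial m s) = letterScalar k w a φ m l • monomial m s := by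
  simp only [letterOp, letterScalar, LinearMap.add_apply, LinearMap.smul_apply, LinearMap.id_apply,
    LinearMap.sum_apply, LinearMap.comp_apply, LinearMap.mulLeft_apply, Derivation.coeFn_coe,
    X_mul_pderiv_monomial_eq, smul_smul, ← Finset.sum_smul, ← add_smul]

/-- Multiplies every monomial in the letters by the product of the letter scalars. -/
noncomputable def wordOp (k : Type*) [Field k] (w : Fin n → ℕ) (a : Fin n →₀ ℕ)
    (φ : Fin r → Fin n) : Module.End k (MvPolynomial (Fin r) k) :=
  ((List.finRange r).map (letterOp k w a φ)).prod

theorem wordOp_monomial (w : Fin n → ℕ) (a : Fin n →₀ ℕ) (φ : Fin r → Fin n)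
    (m : Fin r →₀ ℕ) (s : k) :
    wordOp k w a φ (monomial m s) = (∏ l, letterScalar k w a φ m l) • monomial m s := by
  rw [wordOp, Fin.prod_univ_def]
  induction List.finRange r with
  | nil => simp
  | cons l ls ih =>
    rw [List.map_cons, List.prod_cons, Module.End.mul_apply, ih, map_smul, letterOp_monomial,
      List.map_cons, List.prod_cons, smul_smul, mul_comm]

/-- A differential operator of order one lowers the order of vanishing by at most one. -/
theorem pow_dvd_letterOp (w : Fin n → ℕ) (a : Fin n →₀ ℕ) (φ : Fin r → Fin n) (l : Fin r)
    {p g : MvPolynomial (Fin r) k} {j : ℕ} (h : p ^ (j + 1) ∣ g) :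
    p ^ j ∣ letterOp k w a φ l g := by
  have h' : p ^ j ∣ g := (pow_dvd_pow p j.le_succ).trans h
  simp only [letterOp, LinearMap.add_apply, LinearMap.smul_apply, LinearMap.id_apply,
    LinearMap.sum_apply, LinearMap.comp_apply, LinearMap.mulLeft_apply, Derivation.coeFn_coe]
  refine dvd_add (dvd_smul_of_dvd _ h') (Finset.dvd_sum fun l' _ => dvd_smul_of_dvd _
    (Dvd.dvd.mul_left ?_ _))
  obtain ⟨u, rfl⟩ := h
  rw [Derivation.leibniz, Derivation.leibniz_pow, Nat.add_sub_cancel]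
  simp only [smul_eq_mul, nsmul_eq_mul]
  refine dvd_add (Dvd.dvd.mul_right (pow_dvd_pow p j.le_succ) _) ?_
  exact ⟨u * (((j + 1 : ℕ) : MvPolynomial (Fin r) k) * pderiv l' p), by ring⟩

/-- The `r` letter operators use up at most `r` of the `r + 1` diagonal factors, and identifying the
two letters kills the remaining one. -/
theorem rename_wordOp_eq_zero (w : Fin n → ℕ) (a : Fin n →₀ ℕ) (φ : Fin r → Fin n) {l₁ l₂ : Fin r}
    (hφ : φ l₁ = φ l₂) {g : MvPolynomial (Fin r) k} (hg : (X l₁ - X l₂) ^ (r + 1) ∣ g) :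
    rename φ (wordOp k w a φ g) = 0 := by
  have key : ∀ (ls : List (Fin r)) (j : ℕ) (g : MvPolynomial (Fin r) k),
      (X l₁ - X l₂ : MvPolynomial (Fin r) k) ^ (ls.length + j) ∣ g →
      (X l₁ - X l₂ : MvPolynomial (Fin r) k) ^ j ∣ (ls.map (letterOp k w a φ)).prod g := by
    intro ls
    induction ls with
    | nil => intro j g h; simpa using h
    | cons l ls ih =>
      intro j g h
      rw [List.map_cons, List.prod_cons, Module.End.mul_apply]
      refine pow_dvd_letterOp w a φ l (ih _ _ ?_)
      rwa [List.length_cons, add_assoc, add_comm 1 j] at h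
  have := key (List.finRange r) 1 g (by rwa [List.length_finRange])
  rw [pow_one] at this
  obtain ⟨u, hu⟩ := this
  rw [wordOp, hu, map_mul, map_sub, rename_X, rename_X, hφ, sub_self, zero_mul]

/-- The bilinear operation with `(x^m, x^a) ↦ ∏ (aᵢ + wᵢ (mᵢ + 1)) x^(a + m)`. -/
noncomputable def transvect (k : Type*) [Field k] {n : ℕ} (w : Fin n → ℕ) :
    MvPolynomial (Fin n) k →ₗ[k] MvPolynomial (Fin n) k →ₗ[k] MvPolynomial (Fin n) k :=
  (basisMonomials (Fin n) k).constr k fun m => (basisMonomials (Fin n) k).constr k fun a =>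
    monomial (a + m) (∏ i, ((a i : k) + w i * (m i + 1)))

theorem transvect_monomial (w : Fin n → ℕ) (m a : Fin n →₀ ℕ) (s t : k) :
    transvect k w (monomial m s) (monomial a t) =
      (∏ i, ((a i : k) + w i * (m i + 1))) • monomial (a + m) (s * t) := by
  have h : ∀ (b : Fin n →₀ ℕ) (u : k), monomial b u = u • basisMonomials (Fin n) k b := by
    intro b u
    rw [coe_basisMonomials, smul_monomial, smul_eq_mul, mul_one]
  rw [h m, h a, map_smul, map_smul, LinearMap.smul_apply, transvect, Module.Basis.constr_basis,
    Module.Basis.constr_basis, smul_monomial, smul_monomial, smul_monomial]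
  simp only [smul_eq_mul]
  congr 1
  ring

/-- No two letters act on the same variable, so the interaction terms in `letterScalar` vanish. -/
theorem rename_wordOp_of_injective (w : Fin n → ℕ) (a : Fin n →₀ ℕ) {φ : Fin n → Fin n}
    (hφ : Function.Injective φ) (g : MvPolynomial (Fin n) k) (s : k) :
    rename φ (wordOp k w a φ g) * monomial a s = transvect k w (rename φ g) (monomial a s) := by
  induction g using MvPolynomial.induction_on' with
  | monomial m t =>
    rw [wordOp_monomial, map_smul, rename_monomial, transvect_monomial, smul_mul_assoc,
      monomial_mul, add_comm a]
    congr 1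
    refine Eq.trans ?_ ((Equiv.ofBijective φ (Finite.injective_iff_bijective.1 hφ)).prod_comp _)
    refine Finset.prod_congr rfl fun l _ => ?_
    rw [letterScalar_eq, Equiv.ofBijective_apply, Finsupp.mapDomain_apply hφ,
      Finset.sum_eq_zero]
    · ring
    · intro l' _
      rw [if_neg]
      rintro ⟨h1, h2⟩
      exact h1.ne (hφ h2).symm
  | add p q hp hq => rw [map_add, map_add, add_mul, hp, hq, map_add, map_add, LinearMap.add_apply]

/-- A subspace closed under the operators is closed under the operations `transvect g` for symmetric
polynomials `g` that vanish to sufficiently high order on all diagonals. -/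
theorem transvect_mem [CharZero k] {w : Fin n → ℕ} {v : ℕ} {S : Submodule k (MvPolynomial (Fin n) k)}
    (hS : OpClosed (densityOp k w v) S) {g : MvPolynomial (Fin n) k} (hsymm : g.IsSymmetric)
    (hX : ∀ m ∈ g.support, ∀ i, m i ≠ 0)
    (hdiag : ∀ i j, i ≠ j → (X i - X j) ^ (n + 1) ∣ g) {f : MvPolynomial (Fin n) k} (hf : f ∈ S) :
    transvect k w g f ∈ S := by
  classical
  -- By symmetry of `g` every permutation contributes the same term, so the total must be divided by
  -- their number.
  let N : ℕ := (Finset.univ.filter fun φ : Fin n → Fin n => Function.Injective φ).card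
  have hN : (N : k) ≠ 0 := by
    rw [Nat.cast_ne_zero]
    exact Finset.card_ne_zero_of_mem (a := id)
      (Finset.mem_filter.2 ⟨Finset.mem_univ _, Function.injective_id⟩)
  have hmon : ∀ (a : Fin n →₀ ℕ) (s : k),
      ∑ m ∈ g.support, coeff m g •
        (List.ofFn fun l => densityOp k w v (m l)).prod (monomial a s) =
        (N : k) • transvect k w g (monomial a s) := by
    intro a s
    have h1 : ∀ m ∈ g.support, coeff m g •
        (List.ofFn fun l => densityOp k w v (m l)).prod (monomial a s) =
        ∑ φ : Fin n → Fin n,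
          rename φ (wordOp k w a φ (monomial m (coeff m g))) * monomial a s := by
      intro m hm
      -- Nonzero exponents are needed here: the shift `v` in the operator for `m = 0` is not part of
      -- any `localOp`.
      have : (fun l => densityOp k w v (m l)) = fun l => ∑ i, localOp k w i (m l) :=
        funext fun l => densityOp_eq_sum_localOp w v (hX m hm l)
      rw [this, prod_ofFn_sum fun i l => localOp k w i (m l), LinearMap.sum_apply,
        Finset.smul_sum]
      refine Finset.sum_congr rfl fun φ _ => ?_
      rw [prod_localOp_monomial, wordOp_monomial, map_smul, rename_monomial, smul_mul_assoc,
        monomial_mul, smul_comm, smul_monomial, smul_eq_mul, add_comm a]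
    rw [Finset.sum_congr rfl h1, Finset.sum_comm]
    have h2 : ∀ φ : Fin n → Fin n, ∑ m ∈ g.support,
        rename φ (wordOp k w a φ (monomial m (coeff m g))) * monomial a s =
        if Function.Injective φ then transvect k w g (monomial a s) else 0 := by
      intro φ
      rw [← Finset.sum_mul, ← map_sum, ← map_sum, ← g.as_sum]
      split_ifs with hφ
      · rw [rename_wordOp_of_injective w a hφ]
        congr 2
        exact hsymm (Equiv.ofBijective φ (Finite.injective_iff_bijective.1 hφ))
      · simp only [Function.Injective, not_forall] at hφ
        obtain ⟨l₁, l₂, h, hne⟩ := hφ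
        rw [rename_wordOp_eq_zero w a φ h (hdiag _ _ hne), zero_mul]
    rw [Finset.sum_congr rfl fun φ _ => h2 φ, ← Finset.sum_filter, Finset.sum_const,
      Nat.cast_smul_eq_nsmul]
  have hall : ∑ m ∈ g.support, coeff m g • (List.ofFn fun l => densityOp k w v (m l)).prod f =
      (N : k) • transvect k w g f := by
    clear hf
    induction f using MvPolynomial.induction_on' with
    | monomial a s => exact hmon a s
    | add p q hp hq => simp only [map_add, smul_add, Finset.sum_add_distrib, hp, hq]
  rw [← Submodule.smul_mem_iff S hN, ← hall]
  refine Submodule.sum_mem _ fun m _ => S.smul_mem _ ?_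
  have hprod : ∀ ls : List (Module.End k (MvPolynomial (Fin n) k)),
      (∀ D ∈ ls, ∀ x ∈ S, D x ∈ S) → ls.prod f ∈ S := by
    intro ls
    induction ls with
    | nil => intro _; simpa using hf
    | cons D ls ih =>
      intro h
      rw [List.prod_cons, Module.End.mul_apply]
      exact h D List.mem_cons_self _ (ih fun D' hD' => h D' (List.mem_cons_of_mem _ hD'))
  refine hprod _ fun D hD => ?_
  obtain ⟨l, rfl⟩ := List.mem_ofFn.1 hD
  exact hS (m l)

end Polarization

/-! ### From transvections to multiplication operators -/

section Core

variable {k : Type*} [Field k] {n : ℕ}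

/-- The product of all variables. -/
noncomputable def prodX (k : Type*) [Field k] (n : ℕ) : MvPolynomial (Fin n) k := ∏ i, X i

/-- The Vandermonde product. -/
noncomputable def vand (k : Type*) [Field k] (n : ℕ) : MvPolynomial (Fin n) k :=
  ∏ i, ∏ j ∈ Finset.Ioi i, (X j - X i)

/-- A symmetric polynomial that is divisible by all variables and vanishes to high order on all
diagonals. -/
noncomputable def diagPoly (k : Type*) [Field k] (n : ℕ) : MvPolynomial (Fin n) k :=
  prodX k n * (vand k n ^ 2) ^ (n + 1)

theorem prodX_pow (t : ℕ) :
    prodX k n ^ t = monomial (Finsupp.equivFunOnFinite.symm fun _ : Fin n => t) 1 := by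
  rw [prodX, ← Finset.prod_pow, monomial_eq, Finsupp.prod_fintype _ _ (by simp)]
  simp

theorem prodX_isSymmetric : (prodX k n).IsSymmetric := by
  intro σ
  rw [prodX, map_prod]
  simp only [rename_X]
  exact Equiv.prod_comp σ X

/-- Permuting the rows of the Vandermonde determinant changes only its sign. -/
theorem vand_sq_isSymmetric : (vand k n ^ 2).IsSymmetric := by
  intro σ
  have h1 : vand k n = (Matrix.vandermonde (X : Fin n → MvPolynomial (Fin n) k)).det :=
    (Matrix.det_vandermonde _).symm
  have h2 : rename σ (vand k n) =
      ((Matrix.vandermonde (X : Fin n → MvPolynomial (Fin n) k)).submatrix σ id).det := by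
    have : (Matrix.vandermonde (X : Fin n → MvPolynomial (Fin n) k)).submatrix σ id =
        Matrix.vandermonde fun i => X (σ i) := by
      ext i j
      simp [Matrix.vandermonde_apply]
    rw [this, Matrix.det_vandermonde, vand, map_prod]
    simp
  rw [map_pow, h2, Matrix.det_permute, ← h1, mul_pow]
  rcases Int.units_eq_one_or (Equiv.Perm.sign σ) with h | h <;> simp [h]

theorem diagPoly_isSymmetric : (diagPoly k n).IsSymmetric := by
  intro σ
  rw [diagPoly, map_mul, map_pow, prodX_isSymmetric, vand_sq_isSymmetric]

theorem X_sub_X_dvd_vand {i j : Fin n} (hij : i ≠ j) : X i - X j ∣ vand k n := by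
  wlog h : j < i generalizing i j
  · rw [← neg_sub, neg_dvd]
    exact this hij.symm (lt_of_le_of_ne (not_lt.1 h) hij)
  · exact (Finset.dvd_prod_of_mem (fun i => X i - X j) (Finset.mem_Ioi.2 h)).trans
      (Finset.dvd_prod_of_mem (fun j => ∏ i ∈ Finset.Ioi j, (X i - X j)) (Finset.mem_univ j))

theorem pow_dvd_diagPoly {i j : Fin n} (hij : i ≠ j) :
    (X i - X j) ^ (n + 1) ∣ diagPoly k n := by
  refine Dvd.dvd.mul_left (pow_dvd_pow_of_dvd ?_ _) _
  exact (X_sub_X_dvd_vand hij).trans (dvd_pow_self _ two_ne_zero)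

theorem support_prodX_mul (g : MvPolynomial (Fin n) k) {m : Fin n →₀ ℕ}
    (hm : m ∈ (prodX k n * g).support) (i : Fin n) : m i ≠ 0 := by
  rw [mem_support_iff, ← pow_one (prodX k n), prodX_pow, coeff_monomial_mul'] at hm
  have h : (Finsupp.equivFunOnFinite.symm fun _ : Fin n => 1) ≤ m := by
    by_contra h
    exact hm (if_neg h)
  have := h i
  rw [Finsupp.equivFunOnFinite_symm_apply_apply] at this
  omega

theorem transvect_diagPoly_mul_mem [CharZero k] {w : Fin n → ℕ} {v : ℕ}
    {S : Submodule k (MvPolynomial (Fin n) k)} (hS : OpClosed (densityOp k w v) S)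
    {h : MvPolynomial (Fin n) k} (hh : h.IsSymmetric) {f : MvPolynomial (Fin n) k} (hf : f ∈ S) :
    transvect k w (diagPoly k n * h) f ∈ S := by
  refine transvect_mem hS ?_ (fun m hm i => ?_) (fun i j hij => ?_) hf
  · intro σ
    rw [map_mul, diagPoly_isSymmetric, hh]
  · rw [diagPoly, mul_assoc] at hm
    exact support_prodX_mul _ hm i
  · exact Dvd.dvd.mul_right (pow_dvd_diagPoly hij) _

/-- The product of the Euler operators of the variables of weight zero. -/
noncomputable def eulerZero (k : Type*) [Field k] {n : ℕ} (w : Fin n → ℕ) :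
    Module.End k (MvPolynomial (Fin n) k) :=
  ((Finset.univ.filter fun i => w i = 0).toList.map fun i =>
    ((X i : MvPolynomial (Fin n) k) • pderiv (R := k) i).toLinearMap).prod

theorem eulerZero_monomial (w : Fin n → ℕ) (a : Fin n →₀ ℕ) (s : k) :
    eulerZero k w (monomial a s) = (∏ i, if w i = 0 then (a i : k) else 1) • monomial a s := by
  rw [eulerZero, ← Finset.prod_filter, ← Finset.prod_map_toList]
  induction (Finset.univ.filter fun i => w i = 0).toList with
  | nil => simp
  | cons i ls ih =>
    have h : ((X i : MvPolynomial (Fin n) k) • pderiv (R := k) i).toLinearMap (monomial a s) =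
        (a i : k) • monomial a s := X_mul_pderiv_monomial_eq i a s
    rw [List.map_cons, List.prod_cons, Module.End.mul_apply, ih, map_smul, h,
      List.map_cons, List.prod_cons, smul_smul, mul_comm]

theorem coeff_prod_of_natDegree_le {ι : Type*} (s : Finset ι) (q : ι → Polynomial k) (d : ι → ℕ)
    (h : ∀ i ∈ s, (q i).natDegree ≤ d i) :
    (∏ i ∈ s, q i).natDegree ≤ ∑ i ∈ s, d i ∧
      (∏ i ∈ s, q i).coeff (∑ i ∈ s, d i) = ∏ i ∈ s, (q i).coeff (d i) := by
  classical
  induction s using Finset.induction_on with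
  | empty => simp
  | insert a s ha ih =>
    obtain ⟨ih1, ih2⟩ := ih fun i hi => h i (Finset.mem_insert_of_mem hi)
    have ha' := h a (Finset.mem_insert_self _ _)
    rw [Finset.prod_insert ha, Finset.sum_insert ha, Finset.prod_insert ha]
    exact ⟨Polynomial.natDegree_mul_le_of_le ha' ih1,
      by rw [Polynomial.coeff_mul_add_eq_of_natDegree_le ha' ih1, ih2]⟩

/-- The number of letters that are differentiated in `transvect_transvect_eq`. -/
def letterDegree (w : Fin n → ℕ) : ℕ := ∑ i, if w i = 0 then 1 else 2

/-- The leading scalar in `transvect_transvect_eq`. -/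
noncomputable def leadScalar (k : Type*) [Field k] (w : Fin n → ℕ) : k :=
  ∏ i, if w i = 0 then -1 else ((w i : k) - 1) * -w i

theorem leadScalar_ne_zero [CharZero k] {w : Fin n → ℕ} (hw : ∀ i, w i ≠ 1) :
    leadScalar k w ≠ 0 := by
  refine Finset.prod_ne_zero_iff.2 fun i _ => ?_
  split_ifs with h
  · exact neg_ne_zero.2 one_ne_zero
  · refine mul_ne_zero ?_ (neg_ne_zero.2 (Nat.cast_ne_zero.2 h))
    rw [sub_ne_zero]
    exact_mod_cast hw i

/-- On monomials the resulting exponent does not depend on `t`, and the scalar is a product of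
factors linear in `t`. Its top coefficient is, up to `leadScalar`, the product of the exponents at
the variables of weight zero, hence `eulerZero`. -/
theorem transvect_transvect_eq (w : Fin n → ℕ) (R : ℕ) (g g' f : MvPolynomial (Fin n) k) :
    ∃ u : ℕ → MvPolynomial (Fin n) k,
      u (letterDegree w) = leadScalar k w • (prodX k n ^ R * (g * (g' * eulerZero k w f))) ∧
      ∀ t ≤ R, transvect k w (prodX k n ^ t * g) (transvect k w (prodX k n ^ (R - t) * g') f) =
        ∑ j ∈ Finset.range (letterDegree w + 1), (t : k) ^ j • u j := by
  induction g using MvPolynomial.induction_on' with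
  | add p q hp hq =>
    obtain ⟨u₁, h₁, h₁'⟩ := hp
    obtain ⟨u₂, h₂, h₂'⟩ := hq
    refine ⟨fun j => u₁ j + u₂ j, ?_, fun t ht => ?_⟩
    · simp only [h₁, h₂, add_mul, mul_add, smul_add]
    · rw [mul_add, map_add, LinearMap.add_apply, h₁' t ht, h₂' t ht]
      simp only [smul_add, Finset.sum_add_distrib]
  | monomial m s =>
    induction g' using MvPolynomial.induction_on' with
    | add p q hp hq =>
      obtain ⟨u₁, h₁, h₁'⟩ := hp
      obtain ⟨u₂, h₂, h₂'⟩ := hq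
      refine ⟨fun j => u₁ j + u₂ j, ?_, fun t ht => ?_⟩
      · simp only [h₁, h₂, add_mul, mul_add, mul_add, smul_add]
      · rw [mul_add, map_add, LinearMap.add_apply, map_add, h₁' t ht, h₂' t ht]
        simp only [smul_add, Finset.sum_add_distrib]
    | monomial m' s' =>
      induction f using MvPolynomial.induction_on' with
      | add p q hp hq =>
        obtain ⟨u₁, h₁, h₁'⟩ := hp
        obtain ⟨u₂, h₂, h₂'⟩ := hq
        refine ⟨fun j => u₁ j + u₂ j, ?_, fun t ht => ?_⟩
        · simp only [h₁, h₂, map_add, mul_add, smul_add]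
        · rw [map_add, map_add, h₁' t ht, h₂' t ht]
          simp only [smul_add, Finset.sum_add_distrib]
      | monomial a r =>
        -- The outer transvection contributes `A i + (w i - 1) t` and the inner one `B i - w i t`.
        -- In weight zero the latter is the constant `a i`, whence the degree `1` in `d`.
        let A : Fin n → k := fun i => (a i : k) + m' i + R + w i * (m i + 1)
        let B : Fin n → k := fun i => (a i : k) + w i * (m' i + R + 1)
        let q : Fin n → Polynomial k := fun i =>
          (Polynomial.C ((w i : k) - 1) * Polynomial.X + Polynomial.C (A i)) *
            (Polynomial.C (-(w i : k)) * Polynomial.X + Polynomial.C (B i))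
        let d : Fin n → ℕ := fun i => if w i = 0 then 1 else 2
        have hq : ∀ i ∈ Finset.univ, (q i).natDegree ≤ d i := by
          intro i _
          simp only [q, d]
          split_ifs with h
          · simp only [h, Nat.cast_zero, neg_zero, map_zero, zero_mul, zero_add]
            compute_degree
          · compute_degree
        have hc : ∀ i, (q i).coeff (d i) = (if w i = 0 then -1 else ((w i : k) - 1) * -w i) *
            (if w i = 0 then (a i : k) else 1) := by
          intro i
          simp only [q, d]
          split_ifs with h
          · simp only [h, Nat.cast_zero, neg_zero, map_zero, zero_mul, zero_add,
              Polynomial.coeff_mul_C]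
            simp [B, h]
          · rw [mul_one]
            have h1 : (Polynomial.C ((w i : k) - 1) * Polynomial.X + Polynomial.C (A i)).natDegree
                ≤ 1 := Polynomial.natDegree_linear_le
            have h2 : (Polynomial.C (-(w i : k)) * Polynomial.X + Polynomial.C (B i)).natDegree
                ≤ 1 := Polynomial.natDegree_linear_le
            rw [Polynomial.coeff_mul_add_eq_of_natDegree_le h1 h2]
            simp
        obtain ⟨hdeg, hcoeff⟩ := coeff_prod_of_natDegree_le Finset.univ q d hq
        let o : ℕ → (Fin n →₀ ℕ) := fun t => Finsupp.equivFunOnFinite.symm fun _ => t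
        refine ⟨fun j => (∏ i, q i).coeff j • monomial (o R + (m + (m' + a))) (s * (s' * r)),
          ?_, fun t ht => ?_⟩
        · dsimp only
          rw [eulerZero_monomial, prodX_pow, mul_smul_comm, mul_smul_comm, mul_smul_comm,
            monomial_mul, monomial_mul, monomial_mul, one_mul, smul_smul]
          congr 1
          rw [letterDegree, hcoeff, leadScalar, ← Finset.prod_mul_distrib]
          exact Finset.prod_congr rfl fun i _ => hc i
        · rw [prodX_pow, prodX_pow, monomial_mul, monomial_mul, transvect_monomial, map_smul,
            transvect_monomial, smul_smul, ← Finset.prod_mul_distrib, one_mul, one_mul]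
          have hexp : a + (o (R - t) + m') + (o t + m) = o R + (m + (m' + a)) := by
            ext i
            simp only [o, Finsupp.add_apply, Finsupp.equivFunOnFinite_symm_apply_apply]
            omega
          simp only [smul_smul, ← Finset.sum_smul]
          rw [hexp]
          congr 1
          · have hev := Polynomial.eval_eq_sum_range' (Nat.lt_succ_iff.2 hdeg) (t : k)
            rw [Polynomial.eval_prod] at hev
            simp only [mul_comm ((t : k) ^ _)]
            refine Eq.trans ?_ hev
            refine Finset.prod_congr rfl fun i _ => ?_
            simp only [q, A, B, Polynomial.eval_mul, Polynomial.eval_add, Polynomial.eval_C,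
              Polynomial.eval_X, Finsupp.add_apply, Nat.cast_add,
              Finsupp.equivFunOnFinite_symm_apply_apply, Nat.cast_sub ht]
            ring

/-- Each derivation may lower the power of `c` by one and brings out a factor `j`. Multiplying by `c
^ Ds.length` restores the power, leaving a polynomial in `j`. -/
theorem pow_mul_prod_derivation (Ds : List (Derivation k (MvPolynomial (Fin n) k)
    (MvPolynomial (Fin n) k))) (c g : MvPolynomial (Fin n) k) :
    ∃ u : ℕ → MvPolynomial (Fin n) k,
      u 0 = c ^ Ds.length * (Ds.map fun D => D.toLinearMap).prod g ∧
      (∀ t, Ds.length < t → u t = 0) ∧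
      ∀ j : ℕ, c ^ Ds.length * (Ds.map fun D => D.toLinearMap).prod (c ^ j * g) =
        c ^ j * ∑ t ∈ Finset.range (Ds.length + 1), (j : k) ^ t • u t := by
  induction Ds with
  | nil =>
    refine ⟨fun t => if t = 0 then g else 0, by simp, fun t ht => ?_, fun j => by simp⟩
    exact if_neg (Nat.ne_of_gt ht)
  | cons D Ds ih =>
    obtain ⟨u, h0, hbig, hu⟩ := ih
    have step : ∀ x y : MvPolynomial (Fin n) k, c ^ Ds.length * x = y →
        c ^ (Ds.length + 1) * D x = c * D y - (Ds.length : k) • (D c * y) := by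
      rintro x y rfl
      rw [Derivation.leibniz, Derivation.leibniz_pow, smul_eq_C_mul, map_natCast]
      simp only [smul_eq_mul, nsmul_eq_mul]
      rcases Ds.length with _ | r
      · simp
      · rw [Nat.add_sub_cancel]
        ring
    refine ⟨fun t => (if t = 0 then 0 else D c * u (t - 1)) +
      (c * D (u t) - (Ds.length : k) • (D c * u t)), ?_, fun t ht => ?_, fun j => ?_⟩
    · dsimp only
      rw [if_pos rfl, zero_add, h0, List.map_cons, List.prod_cons, Module.End.mul_apply,
        List.length_cons]
      exact (step _ _ rfl).symm
    · rw [List.length_cons] at ht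
      dsimp only
      rw [if_neg (by omega), hbig _ (by omega), hbig _ (by omega)]
      simp
    · rw [List.map_cons, List.prod_cons, Module.End.mul_apply, List.length_cons]
      refine (step _ _ (hu j)).trans ?_
      have hs : ∑ t ∈ Finset.range (Ds.length + 1 + 1), (j : k) ^ t •
          ((if t = 0 then 0 else D c * u (t - 1)) +
            (c * D (u t) - (Ds.length : k) • (D c * u t))) =
          (j : k) • (D c * ∑ t ∈ Finset.range (Ds.length + 1), (j : k) ^ t • u t) +
            (c * D (∑ t ∈ Finset.range (Ds.length + 1), (j : k) ^ t • u t) -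
              (Ds.length : k) • (D c * ∑ t ∈ Finset.range (Ds.length + 1), (j : k) ^ t • u t)) := by
        simp only [smul_add, Finset.sum_add_distrib]
        congr 1
        · rw [Finset.sum_range_succ', Finset.mul_sum, Finset.smul_sum]
          simp [pow_succ', smul_smul]
        · rw [Finset.sum_range_succ, hbig (Ds.length + 1) (by omega)]
          simp only [map_sum, Finset.mul_sum, Finset.smul_sum, ← Finset.sum_sub_distrib, map_zero,
            mul_zero, smul_zero, sub_zero, add_zero]
          refine Finset.sum_congr rfl fun t _ => ?_
          rw [D.map_smul, mul_smul_comm, mul_smul_comm, smul_sub, smul_comm (Ds.length : k)]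
      rw [hs, Derivation.leibniz, Derivation.leibniz_pow, smul_eq_C_mul, smul_eq_C_mul,
        smul_eq_C_mul, map_natCast, map_natCast]
      simp only [smul_eq_mul, nsmul_eq_mul]
      rcases j with _ | j
      · simp
      · rw [Nat.add_sub_cancel]
        ring

end Core

/-! ### Multiplying closed subspaces by powers of the conductor -/

section Conductor

variable {k : Type*} [Field k] {n : ℕ}

/-- A symmetric polynomial, multiplication by powers of which preserves closed subspaces. -/
noncomputable def conductor (k : Type*) [Field k] (n : ℕ) : MvPolynomial (Fin n) k :=
  prodX k n ^ (2 * n) * (diagPoly k n * diagPoly k n)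

theorem conductor_isSymmetric : (conductor k n).IsSymmetric := by
  intro σ
  rw [conductor, map_mul, map_mul, map_pow, prodX_isSymmetric, diagPoly_isSymmetric]

theorem letterDegree_le (w : Fin n → ℕ) : letterDegree w ≤ 2 * n := by
  have : letterDegree w ≤ ∑ _i : Fin n, 2 :=
    Finset.sum_le_sum fun i _ => by split_ifs <;> norm_num
  simpa [mul_comm] using this

/-- The top coefficient in `transvect_transvect_eq` is recovered from `letterDegree w + 1` values of
`t`. These fit below `R = 2 * n`, which explains the exponent in `conductor`; excluding weight one
makes `leadScalar` invertible. -/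
theorem conductor_mul_eulerZero_mem [CharZero k] {w : Fin n → ℕ} (hw : ∀ i, w i ≠ 1) {v : ℕ}
    {S : Submodule k (MvPolynomial (Fin n) k)} (hS : OpClosed (densityOp k w v) S)
    {h : MvPolynomial (Fin n) k} (hh : h.IsSymmetric) {f : MvPolynomial (Fin n) k} (hf : f ∈ S) :
    conductor k n * (h * eulerZero k w f) ∈ S := by
  obtain ⟨u, hu, hval⟩ := transvect_transvect_eq w (2 * n) (diagPoly k n) (diagPoly k n * h) f
  have hmem : u (letterDegree w) ∈ S := by
    classical
    refine coeff_mem_of_values_mem (letterDegree w) u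
      ((Finset.range (letterDegree w + 1)).image fun t : ℕ => (t : k)) ?_ ?_ le_rfl
    · rw [Finset.card_image_of_injective _ Nat.cast_injective, Finset.card_range]
      exact Nat.lt_succ_self _
    · intro t' ht'
      obtain ⟨t, ht, rfl⟩ := Finset.mem_image.1 ht'
      have ht : t ≤ 2 * n :=
        (Nat.lt_succ_iff.1 (Finset.mem_range.1 ht)).trans (letterDegree_le w)
      rw [← hval t ht, mul_comm (prodX k n ^ t), mul_left_comm]
      refine transvect_diagPoly_mul_mem hS (fun σ => ?_)
        (transvect_diagPoly_mul_mem hS (fun σ => ?_) hf)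
      · rw [map_pow, prodX_isSymmetric]
      · rw [map_mul, map_pow, prodX_isSymmetric, hh]
  rw [hu, Submodule.smul_mem_iff _ (leadScalar_ne_zero hw)] at hmem
  convert hmem using 1
  rw [conductor]
  ring

/-- The previous step applies to `c ^ j * g`, not to `g` itself. Expanding `eulerZero` of this in
`j` and interpolating extracts the constant coefficient, which is a multiple of `eulerZero g`. -/
theorem conductor_pow_mul_eulerZero_mem [CharZero k] {w : Fin n → ℕ} (hw : ∀ i, w i ≠ 1) {v : ℕ}
    {S : Submodule k (MvPolynomial (Fin n) k)} (hS : OpClosed (densityOp k w v) S) (s : ℕ) :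
    ∃ E : ℕ, ∀ h : MvPolynomial (Fin n) k, h.IsSymmetric → ∀ f ∈ S,
      conductor k n ^ E * (h * (eulerZero k w ^ (s + 1)) f) ∈ S := by
  induction s with
  | zero =>
    exact ⟨1, fun h hh f hf => by simpa using conductor_mul_eulerZero_mem hw hS hh hf⟩
  | succ s ih =>
    obtain ⟨E, hE⟩ := ih
    set c := conductor k n with hc
    have hcs : ∀ j, (c ^ j).IsSymmetric := fun j σ => by rw [map_pow, hc, conductor_isSymmetric]
    let Ds : List (Derivation k (MvPolynomial (Fin n) k) (MvPolynomial (Fin n) k)) :=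
      (Finset.univ.filter fun i => w i = 0).toList.map fun i =>
        (X i : MvPolynomial (Fin n) k) • pderiv (R := k) i
    have hDs : (Ds.map fun D => D.toLinearMap).prod = eulerZero k w := by
      simp only [Ds, List.map_map, eulerZero]
      rfl
    set r := Ds.length with hr
    -- All values of `j` from `E` to `E + r` are brought to the common power `E + r`; one more `c`
    -- comes from `conductor_mul_eulerZero_mem`, and `r` more are contained in `u 0`.
    refine ⟨E + r + 1 + r, fun h hh f hf => ?_⟩
    set g := (eulerZero k w ^ (s + 1)) f with hg
    obtain ⟨u, hu0, -, hu⟩ := pow_mul_prod_derivation Ds c g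
    rw [hDs] at hu0
    simp only [hDs] at hu
    have hmem : c ^ (E + r + 1) * (h * u 0) ∈ S := by
      classical
      refine coeff_mem_of_values_mem r (fun t => c ^ (E + r + 1) * (h * u t))
        ((Finset.Icc E (E + r)).image fun t : ℕ => (t : k)) ?_ ?_ (Nat.zero_le _)
      · rw [Finset.card_image_of_injective _ Nat.cast_injective, Nat.card_Icc]
        omega
      · intro j' hj'
        obtain ⟨j, hj, rfl⟩ := Finset.mem_image.1 hj'
        obtain ⟨hj1, hj2⟩ := Finset.mem_Icc.1 hj
        have h1 : c ^ j * g ∈ S := by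
          have := hE (c ^ (j - E)) (hcs _) f hf
          rwa [← mul_assoc, ← pow_add, Nat.add_sub_cancel' hj1] at this
        have hsymm : (h * c ^ (r + (E + r - j))).IsSymmetric := fun σ => by
          rw [map_mul, hcs, hh]
        have h2 := conductor_mul_eulerZero_mem hw hS hsymm h1
        convert h2 using 1
        have h3 : c ^ (E + r + 1) = c * c ^ (E + r - j) * c ^ j := by
          rw [← pow_succ', ← pow_add]
          congr 1
          omega
        have h4 : ∑ t ∈ Finset.range (r + 1), (j : k) ^ t • (c ^ (E + r + 1) * (h * u t)) =
            c * c ^ (E + r - j) * h * (c ^ j * ∑ t ∈ Finset.range (r + 1), (j : k) ^ t • u t) := by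
          rw [Finset.mul_sum, Finset.mul_sum]
          refine Finset.sum_congr rfl fun t _ => ?_
          rw [h3, mul_smul_comm, mul_smul_comm]
          congr 1
          ring
        rw [h4, ← hu j, pow_add, ← hc]
        ring
    rw [hu0] at hmem
    convert hmem using 1
    rw [pow_succ' (eulerZero k w) (s + 1), Module.End.mul_apply, ← hg, pow_add c (E + r + 1)]
    ring

/-- The eigenvalues of `eulerZero` on the monomials of `f` are nonzero. So `f` is annihilated by a
polynomial in `eulerZero` with nonzero constant term and is a combination of the images under
positive powers. -/
theorem mem_of_eulerZero_pow_mem {w : Fin n → ℕ} {f : MvPolynomial (Fin n) k}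
    [CharZero k] (hf : ∀ a ∈ f.support, ∀ i, a i ≠ 0) :
    ∃ s₀ : ℕ, ∀ W : Submodule k (MvPolynomial (Fin n) k),
      (∀ s < s₀, (eulerZero k w ^ (s + 1)) f ∈ W) → f ∈ W := by
  classical
  let β : (Fin n →₀ ℕ) → k := fun a => ∏ i, if w i = 0 then (a i : k) else 1
  let p : Polynomial k := ∏ a ∈ f.support, (Polynomial.X - Polynomial.C (β a))
  have hmon : ∀ a s, eulerZero k w (monomial a s) = β a • monomial a s := eulerZero_monomial w
  have hp0 : p.coeff 0 ≠ 0 := by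
    rw [Polynomial.coeff_zero_eq_eval_zero, Polynomial.eval_prod, Finset.prod_ne_zero_iff]
    intro a ha
    rw [Polynomial.eval_sub, Polynomial.eval_X, Polynomial.eval_C, zero_sub, neg_ne_zero]
    refine Finset.prod_ne_zero_iff.2 fun i _ => ?_
    split_ifs
    · exact Nat.cast_ne_zero.2 (hf a ha i)
    · exact one_ne_zero
  have hkill : Polynomial.aeval (eulerZero k w) p f = 0 := by
    rw [f.as_sum, map_sum]
    refine Finset.sum_eq_zero fun a ha => ?_
    have : Module.End.HasEigenvector (eulerZero k w) (β a) (monomial a (coeff a f)) :=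
      ⟨Module.End.mem_eigenspace_iff.2 (hmon _ _), by
        rw [Ne, monomial_eq_zero]; exact mem_support_iff.1 ha⟩
    rw [Module.End.aeval_apply_of_hasEigenvector this, Polynomial.eval_prod,
      Finset.prod_eq_zero ha, zero_smul]
    simp
  refine ⟨p.natDegree, fun W hW => ?_⟩
  rw [Polynomial.aeval_eq_sum_range, Finset.sum_range_succ', LinearMap.add_apply,
    LinearMap.sum_apply, pow_zero, LinearMap.smul_apply, Module.End.one_apply] at hkill
  rw [← Submodule.smul_mem_iff W hp0, eq_neg_of_add_eq_zero_right hkill]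
  refine W.neg_mem (W.sum_mem fun s hs => ?_)
  rw [LinearMap.smul_apply]
  exact W.smul_mem _ (hW s (Finset.mem_range.1 hs))

/-- A closed subspace contains the multiples of each of its elements by a power of the conductor
times symmetric polynomials. -/
theorem exists_conductor_pow_mul_mem [CharZero k] {w : Fin n → ℕ} (hw : ∀ i, w i ≠ 1) {v : ℕ}
    {S : Submodule k (MvPolynomial (Fin n) k)} (hS : OpClosed (densityOp k w v) S)
    (hSX : S ≤ multiples (prodX k n)) {f : MvPolynomial (Fin n) k} (hf : f ∈ S) :
    ∃ E₀ : ℕ, ∀ E, E₀ ≤ E → ∀ h : MvPolynomial (Fin n) k, h.IsSymmetric →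
      conductor k n ^ E * (h * f) ∈ S := by
  obtain ⟨s₀, hs₀⟩ := mem_of_eulerZero_pow_mem (k := k) (w := w) (f := f) (by
    obtain ⟨g, rfl⟩ := mem_multiples.1 (hSX hf)
    exact fun a ha i => support_prodX_mul g ha i)
  choose E hE using conductor_pow_mul_eulerZero_mem hw hS
  refine ⟨∑ s ∈ Finset.range s₀, E s, fun E' hE' h hh => ?_⟩
  refine hs₀ (S.comap (LinearMap.mulLeft k (conductor k n ^ E') ∘ₗ LinearMap.mulLeft k h)) ?_
  intro s hs
  have hle : E s ≤ E' :=
    (Finset.single_le_sum (f := E) (fun _ _ => Nat.zero_le _) (Finset.mem_range.2 hs)).trans hE'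
  have := hE s (conductor k n ^ (E' - E s) * h)
    (fun σ => by rw [map_mul, map_pow, conductor_isSymmetric, hh]) f hf
  rw [Submodule.mem_comap, LinearMap.comp_apply, LinearMap.mulLeft_apply, LinearMap.mulLeft_apply]
  rwa [mul_assoc, ← mul_assoc, ← pow_add, Nat.add_sub_cancel' hle] at this

end Conductor

/-! ### Finiteness over symmetric polynomials; Hilbert series of multiples -/

section Symmetric

variable {k : Type*} [Field k] {n : ℕ}

theorem symmetricSubalgebra_isNoetherianRing :
    IsNoetherianRing (symmetricSubalgebra (Fin n) k) :=
  isNoetherianRing_of_ringEquiv _ (esymmAlgEquiv (Fin n) k (Fintype.card_fin n)).toRingEquiv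

theorem isIntegral_X_symmetricSubalgebra (i : Fin n) :
    IsIntegral (symmetricSubalgebra (Fin n) k) (X i : MvPolynomial (Fin n) k) := by
  -- `-X i` is a root of `∏ (T + X j)`, whose coefficients are elementary symmetric polynomials.
  rw [← neg_neg (X i)]
  refine IsIntegral.neg ?_
  let q : Polynomial (symmetricSubalgebra (Fin n) k) := ∑ j ∈ Finset.range (n + 1),
    Polynomial.C ⟨esymm (Fin n) k j, esymm_isSymmetric _ _ _⟩ * Polynomial.X ^ (n - j)
  have hq : q.map (algebraMap (symmetricSubalgebra (Fin n) k) (MvPolynomial (Fin n) k)) =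
      ∏ i : Fin n, (Polynomial.X + Polynomial.C (X i : MvPolynomial (Fin n) k)) := by
    have := MvPolynomial.prod_C_add_X_eq_sum_esymm k (Fin n)
    rw [this, Polynomial.map_sum, Fintype.card_fin]
    refine Finset.sum_congr rfl fun j _ => ?_
    rw [Polynomial.map_mul, Polynomial.map_pow, Polynomial.map_X, Polynomial.map_C]
    rfl
  refine ⟨q, ?_, ?_⟩
  · refine Polynomial.monic_of_injective (f := algebraMap (symmetricSubalgebra (Fin n) k)
      (MvPolynomial (Fin n) k)) Subtype.val_injective ?_
    rw [hq]
    exact Polynomial.monic_prod_of_monic _ _ fun i _ => Polynomial.monic_X_add_C _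
  · rw [← Polynomial.eval_map, hq, Polynomial.eval_prod]
    refine Finset.prod_eq_zero (Finset.mem_univ i) ?_
    simp

theorem finite_symmetricSubalgebra :
    Module.Finite (symmetricSubalgebra (Fin n) k) (MvPolynomial (Fin n) k) := by
  have : Algebra.IsIntegral (symmetricSubalgebra (Fin n) k) (MvPolynomial (Fin n) k) := by
    refine ⟨fun f => ?_⟩
    induction f using MvPolynomial.induction_on with
    | C a =>
      have : (C a : MvPolynomial (Fin n) k) =
          algebraMap (symmetricSubalgebra (Fin n) k) _ (algebraMap k _ a) := rfl
      rw [this]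
      exact isIntegral_algebraMap
    | add p q hp hq => exact hp.add hq
    | mul_X p i hp => exact hp.mul (isIntegral_X_symmetricSubalgebra i)
  have : Algebra.FiniteType (symmetricSubalgebra (Fin n) k) (MvPolynomial (Fin n) k) :=
    Algebra.FiniteType.of_restrictScalars_finiteType k _ _
  exact Algebra.IsIntegral.finite

theorem vf_rename (m : ℕ) (σ : Equiv.Perm (Fin n)) (f : MvPolynomial (Fin n) k) :
    rename σ (vf k n m f) = vf k n m (rename σ f) := by
  induction f using MvPolynomial.induction_on with
  | C a => simp [← algebraMap_eq]
  | add p q hp hq => simp [hp, hq]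
  | mul_X p j hp =>
    rw [Derivation.leibniz, smul_eq_mul, smul_eq_mul, map_add, map_mul, map_mul, hp, map_mul,
      Derivation.leibniz, smul_eq_mul, smul_eq_mul, vf_X, map_pow, rename_X, vf_X]

theorem vf_isSymmetric {f : MvPolynomial (Fin n) k} (hf : f.IsSymmetric) (m : ℕ) :
    (vf k n m f).IsSymmetric := fun σ => by rw [vf_rename, hf]

/-- The module over the symmetric polynomials generated by a closed subspace is closed. -/
theorem opClosed_span {w : Fin n → ℕ} {v : ℕ} {S : Submodule k (MvPolynomial (Fin n) k)}
    (hS : OpClosed (densityOp k w v) S) :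
    OpClosed (densityOp k w v)
      ((Submodule.span (symmetricSubalgebra (Fin n) k)
        (S : Set (MvPolynomial (Fin n) k))).restrictScalars k) := by
  intro m x hx
  rw [Submodule.restrictScalars_mem] at *
  induction hx using Submodule.span_induction with
  | mem x hx => exact Submodule.subset_span (hS m x hx)
  | zero => simp
  | add x y _ _ hx hy => rw [map_add]; exact Submodule.add_mem _ hx hy
  | smul b x hx' hx =>
    have hmem : ∀ (c : MvPolynomial (Fin n) k), c.IsSymmetric → ∀ y ∈ Submodule.span
        (symmetricSubalgebra (Fin n) k) (S : Set (MvPolynomial (Fin n) k)), c * y ∈ Submodule.span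
        (symmetricSubalgebra (Fin n) k) (S : Set (MvPolynomial (Fin n) k)) := by
      intro c hc y hy
      have := Submodule.smul_mem _ (⟨c, hc⟩ : symmetricSubalgebra (Fin n) k) hy
      rwa [Subalgebra.smul_def] at this
    rw [Subalgebra.smul_def, smul_eq_mul, densityOp_mul]
    exact Submodule.add_mem _ (hmem _ (vf_isSymmetric b.2 m) _ hx') (hmem _ b.2 _ hx)

theorem dvd_vf_X_sub_X (m : ℕ) (i j : Fin n) :
    (X j - X i : MvPolynomial (Fin n) k) ∣ vf k n m (X j - X i) := by
  rw [map_sub, vf_X, vf_X]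
  exact sub_dvd_pow_sub_pow _ _ _

theorem dvd_vf_prodX (m : ℕ) : prodX k n ∣ vf k n m (prodX k n) :=
  dvd_vf_prod _ _ fun i _ => by rw [vf_X]; exact dvd_pow_self _ m.succ_ne_zero

theorem dvd_vf_conductor (m : ℕ) : conductor k n ∣ vf k n m (conductor k n) := by
  have h1 := dvd_vf_prodX (k := k) (n := n) m
  have h2 : vand k n ∣ vf k n m (vand k n) :=
    dvd_vf_prod _ _ fun i _ => dvd_vf_prod _ _ fun j _ => dvd_vf_X_sub_X m i j
  have h3 : diagPoly k n ∣ vf k n m (diagPoly k n) :=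
    dvd_vf_mul h1 (dvd_vf_pow (dvd_vf_pow h2 2) _)
  exact dvd_vf_mul (dvd_vf_pow h1 _) (dvd_vf_mul h3 h3)

theorem exists_conductor_isHomogeneous : ∃ e, n ≤ e ∧ (conductor k n).IsHomogeneous e := by
  have h1 : (prodX k n).IsHomogeneous (∑ _i : Fin n, 1) :=
    IsHomogeneous.prod _ _ _ fun i _ => isHomogeneous_X k i
  have h2 : (vand k n).IsHomogeneous (∑ i : Fin n, ∑ _j ∈ Finset.Ioi i, 1) :=
    IsHomogeneous.prod _ _ _ fun i _ => IsHomogeneous.prod _ _ _ fun j _ =>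
      (isHomogeneous_X k j).sub (isHomogeneous_X k i)
  have h3 : (diagPoly k n).IsHomogeneous _ := h1.mul ((h2.pow 2).pow (n + 1))
  refine ⟨_, ?_, (h1.pow (2 * n)).mul (h3.mul h3)⟩
  simp only [Finset.sum_const, Finset.card_univ, Fintype.card_fin, smul_eq_mul, mul_one]
  omega

theorem vf_zero_of_isHomogeneous {f : MvPolynomial (Fin n) k} {e : ℕ} (hf : f.IsHomogeneous e) :
    vf k n 0 f = (e : MvPolynomial (Fin n) k) * f := by
  rw [vf_eq_sum]
  simpa using hf.sum_X_mul_pderiv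

theorem vand_ne_zero : vand k n ≠ 0 := by
  refine Finset.prod_ne_zero_iff.2 fun i _ => Finset.prod_ne_zero_iff.2 fun j hj => ?_
  rw [sub_ne_zero]
  exact fun h => (Finset.mem_Ioi.1 hj).ne' (X_injective h)

theorem prodX_ne_zero : prodX k n ≠ 0 :=
  Finset.prod_ne_zero_iff.2 fun i _ => X_ne_zero i

theorem conductor_ne_zero : conductor k n ≠ 0 := by
  have : diagPoly k n ≠ 0 :=
    mul_ne_zero prodX_ne_zero (pow_ne_zero _ (pow_ne_zero _ vand_ne_zero))
  exact mul_ne_zero (pow_ne_zero _ prodX_ne_zero) (mul_ne_zero this this)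

theorem exists_conductor_dvd_pow : ∃ J, conductor k n ∣ (prodX k n * vand k n) ^ J := by
  refine ⟨2 * n + 2 + 4 * (n + 1), ?_⟩
  have : conductor k n = prodX k n ^ (2 * n + 2) * vand k n ^ (4 * (n + 1)) := by
    rw [conductor, diagPoly]
    ring
  rw [this, mul_pow]
  exact mul_dvd_mul (pow_dvd_pow _ (by omega)) (pow_dvd_pow _ (by omega))

theorem hilb_densityOp_add [CharZero k] (w : Fin n → ℕ) (v e : ℕ)
    (S : Submodule k (MvPolynomial (Fin n) k)) :
    hilb (densityOp k w (v + e) 0) S = PowerSeries.X ^ e * hilb (densityOp k w v 0) S := by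
  have hop : ∀ f, densityOp k w (v + e) 0 f = densityOp k w v 0 f + (e : k) • f := by
    intro f
    rw [densityOp_apply, densityOp_apply, pot, pot, if_pos rfl, if_pos rfl, smul_eq_C_mul,
      Nat.cast_add, map_add]
    ring
  ext d
  rw [PowerSeries.coeff_X_pow_mul']
  simp only [hilb, PowerSeries.coeff_mk]
  split_ifs with h
  · have : (densityOp k w (v + e) 0).eigenspace (d : k) =
        (densityOp k w v 0).eigenspace ((d - e : ℕ) : k) := by
      ext f
      rw [Module.End.mem_eigenspace_iff, Module.End.mem_eigenspace_iff, hop, Nat.cast_sub h,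
        sub_smul, eq_sub_iff_add_eq]
    rw [this]
  · have : (densityOp k w (v + e) 0).eigenspace (d : k) = ⊥ := by
      rw [eq_bot_iff]
      intro f hf
      rw [Submodule.mem_bot]
      ext a
      have h' := congrArg (coeff a) (Module.End.mem_eigenspace_iff.1 hf)
      rw [coeff_densityOp_zero, coeff_smul, smul_eq_mul, ← sub_eq_zero, ← sub_mul,
        mul_eq_zero, sub_eq_zero, Nat.cast_inj] at h'
      rw [coeff_zero]
      exact h'.resolve_left (by omega)
    rw [this, inf_bot_eq]
    simp

/-- Multiplication by `b` intertwines the Euler operators with shifts `v + e` and `v`. -/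
theorem hilb_map_mulLeft [CharZero k] {w : Fin n → ℕ} {v : ℕ}
    {S : Submodule k (MvPolynomial (Fin n) k)} (hS : OpClosed (densityOp k w v) S)
    {b : MvPolynomial (Fin n) k} (hb0 : b ≠ 0) {e : ℕ} (hb : b.IsHomogeneous e) :
    hilb (densityOp k w v 0) (S.map (LinearMap.mulLeft k b)) =
      PowerSeries.X ^ e * hilb (densityOp k w v 0) S := by
  have hop : ∀ f, densityOp k w (v + e) 0 f = densityOp k w v 0 f + (e : k) • f := by
    intro f
    rw [densityOp_apply, densityOp_apply, pot, pot, if_pos rfl, if_pos rfl, smul_eq_C_mul,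
      Nat.cast_add, map_add]
    ring
  have h := (isGrading_densityOp w (v + e)).hilb_map (S := S) (D' := densityOp k w v 0)
    (LinearMap.mulLeft k b) ?_ ?_
  · have hker : LinearMap.ker (LinearMap.mulLeft k b) = ⊥ :=
      LinearMap.ker_eq_bot.2 fun _ _ h => mul_left_cancel₀ hb0 h
    have h0 : hilb (densityOp k w (v + e) 0) (⊥ : Submodule k (MvPolynomial (Fin n) k)) = 0 := by
      ext d
      simp [hilb]
    rw [hker, inf_bot_eq, h0, add_zero] at h
    rw [h, hilb_densityOp_add]
  · intro f
    rw [LinearMap.mulLeft_apply, LinearMap.mulLeft_apply, densityOp_mul,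
      vf_zero_of_isHomogeneous hb, hop, smul_eq_C_mul, map_natCast]
    ring
  · intro f hf
    rw [hop]
    exact S.add_mem (hS 0 f hf) (S.smul_mem _ hf)

end Symmetric

/-! ### The linear forms dividing the conductor -/

section Forms

variable {k : Type*} [Field k] {n : ℕ}

/-- The linear forms `xᵢ` and `xⱼ - xᵢ`. -/
noncomputable def linForm (k : Type*) [Field k] {n : ℕ} (p : Σ _ : Fin n, Fin n) :
    MvPolynomial (Fin n) k :=
  if p.2 = p.1 then X p.1 else X p.2 - X p.1

theorem prod_linForm :
    ∏ p ∈ Finset.univ.sigma fun i : Fin n => Finset.Ici i, linForm k p = prodX k n * vand k n := by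
  rw [Finset.prod_sigma, prodX, vand, ← Finset.prod_mul_distrib]
  refine Finset.prod_congr rfl fun i _ => ?_
  rw [← Finset.Ioi_insert, Finset.prod_insert (by simp)]
  congr 1
  · simp [linForm]
  · refine Finset.prod_congr rfl fun j hj => ?_
    exact if_neg (Finset.mem_Ioi.1 hj).ne'

/-- Its multiples are the kernel of `restrict i y`, a map to a domain. -/
theorem prime_X_sub_rename (i : Fin (n + 1)) (y : MvPolynomial (Fin n) k) :
    Prime (X i - rename i.succAbove y) := by
  refine ⟨fun h0 => ?_, fun hu => ?_, fun a b hab => ?_⟩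
  · have h1 : restrict i (y + 1) (X i - rename i.succAbove y) = 0 := by rw [h0, map_zero]
    rw [map_sub, restrict_X_self, restrict_rename, add_sub_cancel_left] at h1
    exact one_ne_zero h1
  · have := (restrict_eq_zero_iff i y 1).2 (isUnit_iff_dvd_one.1 hu)
    rw [map_one] at this
    exact one_ne_zero this
  · rw [← restrict_eq_zero_iff, map_mul, mul_eq_zero] at hab
    rwa [← restrict_eq_zero_iff, ← restrict_eq_zero_iff]

theorem prime_linForm (p : Σ _ : Fin n, Fin n) : Prime (linForm k p) := by
  rcases n with _ | n
  · exact p.1.elim0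
  · rw [linForm]
    split_ifs with h
    · have := prime_X_sub_rename (k := k) p.1 0
      rwa [map_zero, sub_zero] at this
    · obtain ⟨t, ht⟩ := Fin.exists_succAbove_eq (Ne.symm h)
      have := prime_X_sub_rename (k := k) p.2 (X t)
      rwa [rename_X, ht] at this

theorem isRelPrime_linForm [CharZero k] {p q : Σ _ : Fin n, Fin n} (hp : p.1 ≤ p.2)
    (hq : q.1 ≤ q.2) (hpq : p ≠ q) : IsRelPrime (linForm k p) (linForm k q) := by
  rw [(prime_linForm p).irreducible.isRelPrime_iff_not_dvd]
  rintro ⟨u, hu⟩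
  obtain ⟨i, j⟩ := p
  obtain ⟨i', j'⟩ := q
  dsimp only at hp hq
  -- Start from distinct nonzero coordinates `t + 1` and change only the `j`-th, so that the form of
  -- `p` is the only one with ordered indices that vanishes at `x`.
  let x : Fin n → k := fun t =>
    if t = j then (if j = i then 0 else ((i : ℕ) : k) + 1) else ((t : ℕ) : k) + 1
  have h1 : eval x (linForm k ⟨i, j⟩) = 0 := by
    simp only [linForm]
    split_ifs with h
    · subst h; simp [x]
    · simp [x, h, Ne.symm h]
  have h2 : eval x (linForm k ⟨i', j'⟩) = 0 := by rw [hu, map_mul, h1, zero_mul]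
  have hne : ¬(i = i' ∧ j = j') := by
    rintro ⟨rfl, rfl⟩
    exact hpq rfl
  have hinj : ∀ a b : Fin n, (((a : ℕ) : k) + 1 = ((b : ℕ) : k) + 1) → a = b := by
    intro a b hab
    exact Fin.ext (Nat.cast_injective (add_right_cancel hab))
  have hpos : ∀ a : Fin n, ((a : ℕ) : k) + 1 ≠ 0 := fun a => Nat.cast_add_one_ne_zero _
  simp only [linForm] at h2
  split_ifs at h2 with h
  · subst h
    simp only [eval_X, x] at h2
    split_ifs at h2 with h3 h4
    · subst h3; subst h4; exact hne ⟨rfl, rfl⟩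
    · exact hpos _ h2
    · exact hpos _ h2
  · simp only [map_sub, eval_X, x, sub_eq_zero] at h2
    split_ifs at h2 with h3 h4 h5 h6 h7
    all_goals first
      | exact hpos _ h2
      | exact hpos _ h2.symm
      | (have := hinj _ _ h2; subst_vars; first | exact hne ⟨rfl, rfl⟩ | exact h rfl | omega)
      | (subst_vars; exact h rfl)

theorem goodForm_linForm [CharZero k] (p : Σ _ : Fin (n + 1), Fin (n + 1))
    (hA : ∀ (w : Fin n → ℕ) (v : ℕ), GoodInt (densityOp k w v) ⊥ ⊤) :
    GoodForm (linForm k p) := by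
  rw [linForm]
  split_ifs with h
  · exact goodForm_X _ hA
  · exact goodForm_X_sub_X h hA

theorem good_multiples_prodX_mul_vand_pow [CharZero k]
    (hA : ∀ (w : Fin n → ℕ) (v : ℕ), GoodInt (densityOp k w v) ⊥ ⊤)
    (w : Fin (n + 1) → ℕ) (v J : ℕ) :
    GoodInt (densityOp k w v) (multiples ((prodX k (n + 1) * vand k (n + 1)) ^ J)) ⊤ := by
  rw [← prod_linForm]
  refine good_multiples_prod _ _ (fun p _ => goodForm_linForm p hA) ?_ w v J
  intro p hp q hq hpq
  have hp := (Finset.mem_sigma.1 (Finset.mem_coe.1 hp)).2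
  have hq := (Finset.mem_sigma.1 (Finset.mem_coe.1 hq)).2
  exact isRelPrime_linForm (Finset.mem_Ici.1 hp) (Finset.mem_Ici.1 hq) hpq

theorem good_multiples_prodX [CharZero k]
    (hA : ∀ (w : Fin n → ℕ) (v : ℕ), GoodInt (densityOp k w v) ⊥ ⊤)
    (w : Fin (n + 1) → ℕ) (v : ℕ) :
    GoodInt (densityOp k w v) (multiples (prodX k (n + 1))) ⊤ := by
  refine (good_multiples_prodX_mul_vand_pow hA w v 1).mono
    (opClosed_multiples dvd_vf_prodX w v) ?_ le_top le_top
  intro f hf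
  rw [mem_multiples, pow_one] at *
  exact (Dvd.intro _ rfl).trans hf

end Forms

/-- A form of the Artin–Rees lemma for the powers of one element. -/
theorem exists_pow_mul_mem_imp {B P : Type*} [CommRing B] [CommRing P] [Algebra B P]
    [IsNoetherianRing B] [Module.Finite B P] (b : B) (K : Submodule B P) :
    ∃ j : ℕ, ∀ g : P, algebraMap B P b ^ j * g ∈ K →
      ∃ x ∈ K, algebraMap B P b ^ j * g = algebraMap B P b * x := by
  obtain ⟨j, hj⟩ := Ideal.exists_pow_inf_eq_pow_smul (Ideal.span {b}) K
  refine ⟨j + 1, fun g hg => ?_⟩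
  have h1 : algebraMap B P b ^ (j + 1) * g ∈
      (Ideal.span {b} ^ (j + 1) • ⊤ ⊓ K : Submodule B P) := by
    refine ⟨?_, hg⟩
    rw [← map_pow, ← Algebra.smul_def]
    exact Submodule.smul_mem_smul (Ideal.pow_mem_pow (Ideal.mem_span_singleton_self b) _) trivial
  rw [hj (j + 1) j.le_succ, Nat.add_sub_cancel_left, pow_one] at h1
  have h2 := Submodule.smul_mono (le_refl (Ideal.span {b}))
    (inf_le_right : Ideal.span {b} ^ j • ⊤ ⊓ K ≤ K) h1
  rw [Submodule.ideal_span_singleton_smul, Submodule.mem_smul_pointwise_iff_exists] at h2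
  obtain ⟨x, hx, h⟩ := h2
  exact ⟨x, hx, by rw [← h, Algebra.smul_def]⟩

/-- Induction on the number of indices with value one. -/
theorem forall_of_forall_ne_one_of_update {n : ℕ} (P : (Fin n → ℕ) → Prop)
    (hP : ∀ w, (∀ i, w i ≠ 1) → P w) (hupd : ∀ w i, w i = 1 → P (Function.update w i 0) → P w)
    (w : Fin n → ℕ) : P w := by
  induction h : (Finset.univ.filter fun i => w i = 1).card generalizing w with
  | zero =>
    refine hP w fun i hi => ?_
    have := Finset.card_eq_zero.1 h
    have : i ∈ Finset.univ.filter fun i => w i = 1 := by simp [hi]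
    simp_all
  | succ c ih =>
    obtain ⟨i, hi⟩ := Finset.card_pos.1 (c.succ_pos.trans_eq h.symm)
    have hi1 := (Finset.mem_filter.1 hi).2
    refine hupd w i hi1 (ih _ ?_)
    have : (Finset.univ.filter fun t => Function.update w i 0 t = 1) =
        (Finset.univ.filter fun t => w t = 1).erase i := by
      ext t
      by_cases ht : t = i <;> simp [ht, Function.update_apply]
    rw [this, Finset.card_erase_of_mem hi, h, Nat.add_sub_cancel]

/-! ### The induction on the number of variables -/

section Main

variable {k : Type*} [Field k] {n : ℕ}

theorem opClosed_map_mulLeft {w : Fin n → ℕ} {v : ℕ} {K : Submodule k (MvPolynomial (Fin n) k)}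
    (hK : OpClosed (densityOp k w v) K)
    (hmul : ∀ c : MvPolynomial (Fin n) k, c.IsSymmetric → ∀ x ∈ K, c * x ∈ K)
    {b : MvPolynomial (Fin n) k} (hb0 : b ≠ 0) (hb : b.IsSymmetric) (hvf : ∀ m, b ∣ vf k n m b) :
    OpClosed (densityOp k w v) (K.map (LinearMap.mulLeft k b)) := by
  rintro m _ ⟨x, hx, rfl⟩
  obtain ⟨c, hc⟩ := hvf m
  -- Multiplication by the quotient `c` has to preserve `K`; cancelling `b` shows that `c` is
  -- symmetric.
  have hcs : c.IsSymmetric := by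
    intro σ
    apply mul_left_cancel₀ hb0
    have := vf_isSymmetric hb m σ
    rwa [hc, map_mul, hb σ] at this
  refine ⟨c * x + densityOp k w v m x, K.add_mem (hmul c hcs x hx) (hK m x hx), ?_⟩
  rw [LinearMap.mulLeft_apply, LinearMap.mulLeft_apply, densityOp_mul, hc]
  ring

/-- Artin–Rees over the Noetherian ring of symmetric polynomials, over which all polynomials form a
finite module. -/
theorem exists_multiples_inf_le_map_mulLeft
    (K : Submodule (symmetricSubalgebra (Fin n) k) (MvPolynomial (Fin n) k))
    {b : MvPolynomial (Fin n) k} (hb : b.IsSymmetric) :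
    ∃ j : ℕ, multiples (b ^ j) ⊓ K.restrictScalars k ≤
      (K.restrictScalars k).map (LinearMap.mulLeft k b) := by
  have := symmetricSubalgebra_isNoetherianRing (k := k) (n := n)
  have := finite_symmetricSubalgebra (k := k) (n := n)
  obtain ⟨j, hj⟩ := exists_pow_mul_mem_imp (⟨b, hb⟩ : symmetricSubalgebra (Fin n) k) K
  refine ⟨j, ?_⟩
  rintro f ⟨hf, hfK⟩
  obtain ⟨g, rfl⟩ := mem_multiples.1 hf
  obtain ⟨x, hx, h⟩ := hj g hfK
  exact ⟨x, hx, h.symm⟩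

theorem exists_finset_span_eq (S : Set (MvPolynomial (Fin n) k)) :
    ∃ T : Finset (MvPolynomial (Fin n) k), (T : Set (MvPolynomial (Fin n) k)) ⊆ S ∧
      Submodule.span (symmetricSubalgebra (Fin n) k) S =
        Submodule.span (symmetricSubalgebra (Fin n) k) T := by
  have := symmetricSubalgebra_isNoetherianRing (k := k) (n := n)
  have := finite_symmetricSubalgebra (k := k) (n := n)
  exact (Submodule.fg_span_iff_fg_span_finset_subset S).1 (IsNoetherian.noetherian _)

theorem exists_conductor_pow_mul_span_le [CharZero k] {w : Fin n → ℕ} (hw : ∀ i, w i ≠ 1) {v : ℕ}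
    {S : Submodule k (MvPolynomial (Fin n) k)} (hS : OpClosed (densityOp k w v) S)
    (hSX : S ≤ multiples (prodX k n)) {T : Finset (MvPolynomial (Fin n) k)}
    (hT : (T : Set (MvPolynomial (Fin n) k)) ⊆ S) :
    ∃ E : ℕ, ((Submodule.span (symmetricSubalgebra (Fin n) k)
      (T : Set (MvPolynomial (Fin n) k))).restrictScalars k).map
        (LinearMap.mulLeft k (conductor k n ^ (E + 1))) ≤ S := by
  have h : ∀ t ∈ T, ∃ E₀ : ℕ, ∀ E, E₀ ≤ E → ∀ h : MvPolynomial (Fin n) k, h.IsSymmetric →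
      conductor k n ^ E * (h * t) ∈ S :=
    fun t ht => exists_conductor_pow_mul_mem hw hS hSX (hT ht)
  choose! E₀ hE₀ using h
  refine ⟨T.sup E₀, ?_⟩
  rintro _ ⟨x, hxT, rfl⟩
  rw [LinearMap.mulLeft_apply]
  suffices ∀ c : MvPolynomial (Fin n) k, c.IsSymmetric →
      conductor k n ^ (T.sup E₀ + 1) * (c * x) ∈ S by
    simpa using this 1 (IsSymmetric.one (σ := Fin n) (R := k))
  have hx : x ∈ Submodule.span (symmetricSubalgebra (Fin n) k)
      (T : Set (MvPolynomial (Fin n) k)) := hxT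
  clear hxT
  induction hx using Submodule.span_induction with
  | mem x hx => exact hE₀ x hx _ ((Finset.le_sup (f := E₀) hx).trans (Nat.le_succ _))
  | zero => intro c _; simp
  | add x y _ _ hx hy =>
    intro c hc
    rw [mul_add, mul_add]
    exact S.add_mem (hx c hc) (hy c hc)
  | smul b x _ hx =>
    intro c hc
    rw [Subalgebra.smul_def, smul_eq_mul, ← mul_assoc c]
    exact hx _ (hc.mul b.2)

theorem isRationalSeries_of_mul_one_sub_X_pow {F : PowerSeries ℚ} {e : ℕ} (he : e ≠ 0)
    (h : IsRationalSeries (F - PowerSeries.X ^ e * F)) : IsRationalSeries F := by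
  refine .of_mul (R := 1 - Polynomial.X ^ e) ?_ ?_
  · rw [Polynomial.coeff_sub, Polynomial.coeff_one_zero, Polynomial.coeff_X_pow,
      if_neg he.symm, sub_zero]
    exact one_ne_zero
  · push_cast
    rwa [sub_mul, one_mul]

theorem hilb_bot {k X : Type*} [Field k] [AddCommGroup X] [Module k X] (D : Module.End k X) :
    hilb D (⊥ : Submodule k X) = 0 := by
  ext d
  simp [hilb]

/-- `S` is squeezed between `bK` and `K`. The interval is good by induction, and `bK` itself is
reached from finitely many generators. -/
theorem good_bot_multiples_prodX [CharZero k]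
    (hA : ∀ (w : Fin n → ℕ) (v : ℕ), GoodInt (densityOp k w v) ⊥ ⊤)
    {w : Fin (n + 1) → ℕ} (hw : ∀ i, w i ≠ 1) (v : ℕ) :
    GoodInt (densityOp k w v) ⊥ (multiples (prodX k (n + 1))) := by
  classical
  intro S hS _ hSX
  set L := densityOp k w v
  obtain ⟨T, hTS, hspan⟩ := exists_finset_span_eq (S : Set (MvPolynomial (Fin (n + 1)) k))
  set K := (Submodule.span (symmetricSubalgebra (Fin (n + 1)) k)
    (S : Set (MvPolynomial (Fin (n + 1)) k))) with hKdef
  have hSK : S ≤ K.restrictScalars k := fun x hx => Submodule.subset_span hx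
  have hKc : OpClosed L (K.restrictScalars k) := opClosed_span hS
  set S₁ := sInf {W | OpClosed L W ∧ (T : Set (MvPolynomial (Fin (n + 1)) k)) ⊆ W} with hS₁
  have hS₁c : OpClosed L S₁ := by
    intro m x hx
    rw [hS₁, Submodule.mem_sInf] at *
    exact fun W hW => hW.1 m x (hx W hW)
  have hTS₁ : (T : Set (MvPolynomial (Fin (n + 1)) k)) ⊆ S₁ := by
    intro x hx
    rw [hS₁, SetLike.mem_coe, Submodule.mem_sInf]
    exact fun W hW => hW.2 hx
  have hS₁S : S₁ ≤ S := sInf_le ⟨hS, hTS⟩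
  -- Working in `S₁` rather than `S` shows that any closed subspace containing `T` already contains
  -- `bK`.
  obtain ⟨E, hE⟩ := exists_conductor_pow_mul_span_le hw hS₁c (hS₁S.trans hSX) hTS₁
  rw [← hspan] at hE
  set b := conductor k (n + 1) ^ (E + 1) with hb
  have hb0 : b ≠ 0 := pow_ne_zero _ conductor_ne_zero
  have hbs : b.IsSymmetric := fun σ => by rw [hb, map_pow, conductor_isSymmetric]
  have hmul : ∀ c : MvPolynomial (Fin (n + 1)) k, c.IsSymmetric →
      ∀ x ∈ K.restrictScalars k, c * x ∈ K.restrictScalars k := by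
    intro c hc x hx
    have := Submodule.smul_mem K (⟨c, hc⟩ : symmetricSubalgebra (Fin (n + 1)) k) hx
    rwa [Subalgebra.smul_def] at this
  have hbKc := opClosed_map_mulLeft hKc hmul hb0 hbs fun m => dvd_vf_pow (dvd_vf_conductor m) _
  set bK := (K.restrictScalars k).map (LinearMap.mulLeft k b)
  have hbKS : bK ≤ S := hE.trans hS₁S
  obtain ⟨j, hj⟩ := exists_multiples_inf_le_map_mulLeft K hbs
  -- Since `(b ^ j) ⊓ K ≤ bK`, the space `K/bK` is a quotient of `K/((b ^ j) ⊓ K)`, which embeds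
  -- into the good quotient by the multiples of `b ^ j`.
  have hgood : GoodInt L bK (K.restrictScalars k) := by
    obtain ⟨J, hJ⟩ := exists_conductor_dvd_pow (k := k) (n := n + 1)
    have hbj : multiples ((prodX k (n + 1) * vand k (n + 1)) ^ (J * ((E + 1) * j))) ≤
        multiples (b ^ j) := by
      intro f hf
      rw [mem_multiples] at *
      refine dvd_trans ?_ hf
      rw [hb, ← pow_mul, pow_mul _ J]
      exact pow_dvd_pow_of_dvd hJ _
    have hc : OpClosed L (multiples (b ^ j)) := opClosed_multiples
      (fun m => dvd_vf_pow (dvd_vf_pow (dvd_vf_conductor m) _) _) w v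
    have h := (good_multiples_prodX_mul_vand_pow hA w v (J * ((E + 1) * j))).mono
      hc hbj le_top le_top (B' := multiples (b ^ j) ⊔ K.restrictScalars k)
    exact (h.inf_of_sup (isGrading_densityOp w v) hc).mono hbKc hj (hbKS.trans hSK) le_rfl
  obtain ⟨⟨T₂, hT₂, hgen⟩, hr⟩ := hgood S hS hbKS hSK
  have hrK := (hgood _ hKc (hbKS.trans hSK) le_rfl).2
  obtain ⟨e, he, hhom⟩ := exists_conductor_isHomogeneous (k := k) (n := n + 1)
  have hbK := hilb_map_mulLeft hKc hb0 (hhom.pow (E + 1))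
  have he0 : e * (E + 1) ≠ 0 := by
    refine mul_ne_zero ?_ ?_ <;> omega
  refine ⟨⟨T ∪ T₂, ?_, ?_⟩, ?_⟩
  · rw [Finset.coe_union]
    exact Set.union_subset hTS hT₂
  · intro W hW _ hTW
    rw [Finset.coe_union, Set.union_subset_iff] at hTW
    exact hgen W hW (hE.trans (sInf_le ⟨hW, hTW.1⟩)) hTW.2
  · change IsRationalSeries (hilb (L 0) (K.restrictScalars k) - hilb (L 0) bK) at hrK
    -- The series of `bK` is `X ^ (e * (E + 1))` times that of `K`, so rationality of the difference
    -- determines that of `K`.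
    have h1 : IsRationalSeries (hilb (L 0) (K.restrictScalars k)) := by
      refine isRationalSeries_of_mul_one_sub_X_pow he0 ?_
      rw [← hbK]
      exact hrK
    have h2 := hr.add (h1.sub hrK)
    rw [hilb_bot]
    convert h2 using 1
    ring

theorem good_bot_top_zero [CharZero k] (w : Fin 0 → ℕ) (v : ℕ) :
    GoodInt (densityOp k w v) ⊥ ⊤ := by
  intro S _ _ _
  have : Module.Finite k (MvPolynomial (Fin 0) k) :=
    Module.Finite.equiv (isEmptyAlgEquiv k (Fin 0)).symm.toLinearEquiv
  constructor
  · obtain ⟨T, hT⟩ := IsNoetherian.noetherian S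
    refine ⟨T, ?_, fun W _ _ hTW => ?_⟩
    · rw [← hT]
      exact Submodule.subset_span
    · rw [← hT]
      exact Submodule.span_le.2 hTW
  · rw [hilb_bot, sub_zero]
    -- Without variables, only the eigenvalue `v` occurs.
    refine ⟨Polynomial.monomial v (PowerSeries.coeff v (hilb (densityOp k w v 0) S)), 1,
      by simp, ?_⟩
    rw [Polynomial.coe_one, one_mul, Polynomial.coe_monomial]
    ext d
    rw [PowerSeries.coeff_monomial]
    split_ifs with h
    · rw [h]
    · have : (densityOp k w v 0).eigenspace (d : k) = ⊥ := by
        rw [eq_bot_iff]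
        intro f hf
        rw [Submodule.mem_bot]
        ext a
        have h' := congrArg (coeff a) (Module.End.mem_eigenspace_iff.1 hf)
        rw [coeff_densityOp_zero, coeff_smul, smul_eq_mul, ← sub_eq_zero, ← sub_mul,
          mul_eq_zero, sub_eq_zero, Nat.cast_inj, Subsingleton.elim a 0] at h'
        rw [coeff_zero, Subsingleton.elim a 0]
        refine h'.resolve_left fun h0 => h ?_
        simpa using h0.symm
      simp [hilb, this]

theorem good_bot_top [CharZero k] (n : ℕ) (w : Fin n → ℕ) (v : ℕ) :
    GoodInt (densityOp k w v) ⊥ ⊤ := by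
  induction n generalizing v with
  | zero => exact good_bot_top_zero w v
  | succ n hA =>
    refine forall_of_forall_ne_one_of_update (fun w => GoodInt (densityOp k w v) ⊥ ⊤)
      (fun w hw => ?_) (fun w i hi h => good_of_weight_one hi h) w
    exact GoodInt.trans (isGrading_densityOp w v) (opClosed_multiples dvd_vf_prodX w v) bot_le
      le_top (good_bot_multiples_prodX hA hw v) (good_multiples_prodX hA w v)

end Main

/-! ### From substitutions to vector fields -/

section Substitution

variable {k : Type*} [Field k] {n : ℕ}

theorem exists_polynomial_subst (m : ℕ) (f : MvPolynomial (Fin n) k) :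
    ∃ q : Polynomial (MvPolynomial (Fin n) k), q.coeff 0 = f ∧ q.coeff 1 = vf k n m f ∧
      ∀ t : k, subst (Polynomial.X + Polynomial.C t * Polynomial.X ^ (m + 1)) f =
        q.eval (C t) := by
  induction f using MvPolynomial.induction_on with
  | C a => exact ⟨Polynomial.C (C a), by simp, by simp [← algebraMap_eq],
      fun t => by simp [subst, ← algebraMap_eq]⟩
  | add f g hf hg =>
    obtain ⟨q, h0, h1, hq⟩ := hf
    obtain ⟨q', h0', h1', hq'⟩ := hg
    refine ⟨q + q', by simp [h0, h0'], by simp [h1, h1'], fun t => ?_⟩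
    rw [map_add, hq, hq', Polynomial.eval_add]
  | mul_X f i hf =>
    obtain ⟨q, h0, h1, hq⟩ := hf
    refine ⟨q * (Polynomial.C (X i) + Polynomial.C (X i ^ (m + 1)) * Polynomial.X), ?_, ?_,
      fun t => ?_⟩
    · simp [Polynomial.mul_coeff_zero, h0]
    · rw [Polynomial.mul_coeff_one, Derivation.leibniz, h0, h1, vf_X, Polynomial.coeff_add,
        Polynomial.coeff_add, Polynomial.coeff_C_mul, Polynomial.coeff_C_mul,
        Polynomial.coeff_C_of_ne_zero one_ne_zero, Polynomial.coeff_C_zero, Polynomial.coeff_X_one,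
        Polynomial.coeff_X_zero, smul_eq_mul, smul_eq_mul]
      ring
    · rw [map_mul, hq, Polynomial.eval_mul]
      congr 1
      rw [subst, aeval_X, map_add, map_mul, map_pow, Polynomial.aeval_X, Polynomial.aeval_C,
        algebraMap_eq, Polynomial.eval_add, Polynomial.eval_mul, Polynomial.eval_C,
        Polynomial.eval_C, Polynomial.eval_X, mul_comm]

theorem densityOp_zero_weight (m : ℕ) (f : MvPolynomial (Fin n) k) :
    densityOp k 0 0 m f = vf k n m f := by
  rw [densityOp_apply, pot]
  simp

theorem IsSubstClosed.opClosed [CharZero k] {S : Submodule k (MvPolynomial (Fin n) k)}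
    (hS : IsSubstClosed S) : OpClosed (densityOp k 0 0) S := by
  classical
  intro m f hf
  obtain ⟨q, -, h1, hq⟩ := exists_polynomial_subst m f
  rw [densityOp_zero_weight, ← h1]
  -- The bound is raised by one so that it covers the index `1` even when `q` is constant.
  refine coeff_mem_of_values_mem (q.natDegree + 1) q.coeff
    ((Finset.range (q.natDegree + 2)).image fun t : ℕ => (t : k)) ?_ (fun t _ => ?_)
    (Nat.le_add_left _ _)
  · rw [Finset.card_image_of_injective _ Nat.cast_injective, Finset.card_range]
    exact Nat.lt_succ_self _
  · have h2 := hS (Polynomial.X + Polynomial.C t * Polynomial.X ^ (m + 1)) (by simp) f hf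
    rw [hq, Polynomial.eval_eq_sum_range' (n := q.natDegree + 1 + 1) (by omega)] at h2
    convert h2 using 2 with j hj
    rw [smul_eq_C_mul, map_pow, mul_comm]

theorem eigenspace_densityOp_zero_weight [CharZero k] (d : ℕ) :
    (densityOp k (0 : Fin n → ℕ) 0 0).eigenspace (d : k) = homogeneousSubmodule (Fin n) k d := by
  apply le_antisymm
  · simpa using eigenspace_densityOp_zero_le (k := k) (0 : Fin n → ℕ) 0 d
  · intro f hf
    rw [Module.End.mem_eigenspace_iff, densityOp_zero_weight, vf_zero_of_isHomogeneous hf,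
      smul_eq_C_mul, map_natCast]

theorem map_subtype_gradedPiece [CharZero k] (S : Submodule k (MvPolynomial (Fin n) k)) (d : ℕ) :
    (gradedPiece S d).map S.subtype =
      S ⊓ (densityOp k (0 : Fin n → ℕ) 0 0).eigenspace (d : k) := by
  rw [gradedPiece, Submodule.map_comap_subtype, eigenspace_densityOp_zero_weight]

theorem generatingSeries_eq_hilb [CharZero k] (S : Submodule k (MvPolynomial (Fin n) k)) :
    generatingSeries S = hilb (densityOp k (0 : Fin n → ℕ) 0 0) S := by
  ext d
  rw [generatingSeries, hilb, PowerSeries.coeff_mk, PowerSeries.coeff_mk,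
    ← map_subtype_gradedPiece, Submodule.finrank_map_subtype_eq]

theorem isInternal_gradedPiece [CharZero k] {S : Submodule k (MvPolynomial (Fin n) k)}
    (hS : OpClosed (densityOp k 0 0) S) : DirectSum.IsInternal (gradedPiece S) := by
  refine DirectSum.isInternal_submodule_of_iSupIndep_of_iSup_eq_top ?_ ?_
  · intro d
    rw [Submodule.disjoint_def]
    intro x hx hx'
    apply Subtype.ext
    have h := fun e => (map_subtype_gradedPiece S e).le.trans inf_le_right
    refine eigenspace_disjoint (densityOp k (0 : Fin n → ℕ) 0 0) d
      (h d (Submodule.mem_map_of_mem hx)) ?_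
    have := Submodule.mem_map_of_mem (f := S.subtype) hx'
    simp only [Submodule.map_iSup] at this
    exact (iSup₂_mono fun e _ => h e) this
  · apply Submodule.map_injective_of_injective S.subtype_injective
    rw [Submodule.map_iSup, Submodule.map_subtype_top]
    simp only [map_subtype_gradedPiece]
    exact ((isGrading_densityOp 0 0).eq_iSup_inf (hS 0)).symm

theorem finiteDimensional_gradedPiece (S : Submodule k (MvPolynomial (Fin n) k)) (d : ℕ) :
    FiniteDimensional k (gradedPiece S d) := by
  have : FiniteDimensional k (homogeneousSubmodule (Fin n) k d) :=
    Module.Finite.iff_fg.2 (homogeneousSubmodule_fg _ _ _)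
  have h : FiniteDimensional k ((gradedPiece S d).map S.subtype) :=
    Submodule.finiteDimensional_of_le (Submodule.map_comap_le S.subtype _)
  exact Module.Finite.equiv
    (Submodule.equivMapOfInjective S.subtype S.subtype_injective (gradedPiece S d)).symm

end Substitution

end SubstSpace

theorem mainTheorem7 {k : Type*} [Field k] [CharZero k] (n : ℕ)
    (S : Submodule k (MvPolynomial (Fin n) k)) (hS : SubstSpace.IsSubstClosed S) :
    DirectSum.IsInternal (SubstSpace.gradedPiece S) ∧
    (∃ T : Set (MvPolynomial (Fin n) k), T.Finite ∧ SubstSpace.substSpan T = S) ∧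
    (∀ d : ℕ, FiniteDimensional k (SubstSpace.gradedPiece S d)) ∧
    (∃ P Q : Polynomial ℚ, Q.coeff 0 ≠ 0 ∧
      (Q : PowerSeries ℚ) * SubstSpace.generatingSeries S = (P : PowerSeries ℚ)) := by
  have hc := hS.opClosed
  obtain ⟨⟨T, hTS, hgen⟩, hr⟩ := SubstSpace.good_bot_top n 0 0 S hc bot_le le_top
  refine ⟨SubstSpace.isInternal_gradedPiece hc, ⟨T, T.finite_toSet, ?_⟩,
    SubstSpace.finiteDimensional_gradedPiece S, ?_⟩
  -- Every competitor is closed under substitutions, hence under the operators; the converse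
  -- implication is not needed.
  · exact le_antisymm (sInf_le ⟨hTS, hS⟩)
      (le_sInf fun W hW => hgen W hW.2.opClosed bot_le hW.1)
  · rw [SubstSpace.hilb_bot, sub_zero, ← SubstSpace.generatingSeries_eq_hilb] at hr
    exact hr
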